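/- Model. Let $n\ge 4$, $k\ge 2$, $d$ be integers, $\boldsymbol\mu_1,\dots,\boldsymbol\mu_k\in\mathbb R^d$ cluster centers, and $\sigma^*:[n]\to[k]$ labels with balanced clusters, $|\{i:\sigma^*(i)=a\}|=n/k$ for every $a\in[k]$. Let $\mathbf g_1,\dots,\mathbf g_n$ be independent random vectors in $\mathbb R^d$ with $\mathbb E\,\mathbf g_i=0$ and sub-Gaussian norm $\|\mathbf g_i\|_{\psi_2}\le\tau$, where $\tau>0$, $\|X\|_{\psi_2}=\inf\{t>0:\mathbb E\exp(X^2/t^2)\le 2\}$ for a random variable and $\|\mathbf x\|_{\psi_2}=\sup_{\|\mathbf u\|_2=1}\|\langle\mathbf x,\mathbf u\rangle\|_{\psi_2}$ for a random vector. We observe $\mathbf h_i=\boldsymbol\mu_{\sigma^*(i)}+\mathbf g_i$, $i\in[n]$. Put $\Delta=\min_{a\ne b}\|\boldsymbol\mu_a-\boldsymbol\mu_b\|_2$ and $s=\Delta/\tau$. Let $A_{ij}=\|\mathbf h_i-\mathbf h_j\|_2^2$, let $Y^*_{ij}=1$ if $\sigma^*(i)=\sigma^*(j)$ and $Y^*_{ij}=0$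 otherwise, let $\|M\|_1=\sum_{i,j}|M_{ij}|$, and consider the semidefinite program (SDP) $$\min_{Y\in\mathbb R^{n\times n}}\ \langle Y,A\rangle\quad\text{subject to}\quad Y\mathbf 1=\tfrac nk\mathbf 1,\quad Y\succeq 0,\quad \operatorname{diag}(Y)=\mathbf 1,\quad Y\ge 0\ \text{entrywise}.$$ (1) There exist universal constants $C_s,C_m,C_e>0$ such that, if $$s^2\ \ge\ C_s\Big(\sqrt{\tfrac{kd}{n}\log n}+\tfrac{kd}{n}+k\Big),$$ then with probability at least $1-2/n$ the SDP has an optimal solution and every optimal solution $\hat Y$ of it satisfies $$\frac{\|\hat Y-Y^*\|_1}{\|Y^*\|_1}\ \le\ C_m\exp\!\Big(-\frac{s^2}{C_e}\Big).$$ (2) (Exact recovery.) For every constant $A_0>0$ there is a constant $C>0$, depending only on $A_0$, such that, if $d\le A_0 n$ and $s^2\ge C(k+\log n)$, then with probability at least $1-2/n$ the SDP has an optimal solution and every optimal solution $\hat Y$ of it satisfies $\|\hat Y-Y^*\|_1<\tfrac14$; in particular, rounding each entry of $\hat Y$ to the nearest integer gives exactly $Y^*$. -/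

import Mathlib

open MeasureTheory ProbabilityTheory
open scoped ENNReal

universe u

noncomputable section

namespace SGMM

/-- The sub-Gaussian norm `inf {t > 0 : E exp (X² / t²) ≤ 2}` of a real random variable, with
value `∞` when there is no such `t`. -/
def psi2Norm {Ω : Type*} [MeasurableSpace Ω] (P : Measure Ω) (X : Ω → ℝ) : ℝ≥0∞ :=
  sInf {r : ℝ≥0∞ | ∃ t : ℝ, 0 < t ∧ r = ENNReal.ofReal t ∧
    ∫⁻ ω, ENNReal.ofReal (Real.exp (X ω ^ 2 / t ^ 2)) ∂P ≤ 2}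

/-- The sub-Gaussian norm of a random vector: the supremum of the sub-Gaussian norms of its
one-dimensional marginals along unit vectors. -/
def psi2NormVec {Ω : Type*} [MeasurableSpace Ω] (P : Measure Ω) {d : ℕ}
    (x : Ω → EuclideanSpace ℝ (Fin d)) : ℝ≥0∞ :=
  ⨆ u ∈ Metric.sphere (0 : EuclideanSpace ℝ (Fin d)) 1, psi2Norm P (fun ω => inner ℝ (x ω) u)

/-- The balanced sub-Gaussian mixture model: `n` points, `k` clusters with labels `σ`, and noise
vectors `g i` that are independent, centered and of sub-Gaussian norm at most `τ`. The cluster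
centers enter only through `point` below. -/
structure IsModel {Ω : Type*} [MeasurableSpace Ω] (P : Measure Ω) {n k d : ℕ}
    (σ : Fin n → Fin k) (g : Fin n → Ω → EuclideanSpace ℝ (Fin d)) (τ : ℝ) : Prop where
  measurable : ∀ i, Measurable (g i)
  indep : iIndepFun g P
  centered : ∀ i, ∫ ω, g i ω ∂P = 0
  tau_pos : 0 < τ
  subgaussian : ∀ i, psi2NormVec P (g i) ≤ ENNReal.ofReal τ
  balanced : ∀ a : Fin k,
    ((Finset.univ.filter (fun i : Fin n => σ i = a)).card : ℝ) = (n : ℝ) / (k : ℝ)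

/-- The observed points: cluster center plus noise. -/
def point {Ω : Type*} {n k d : ℕ} (μ : Fin k → EuclideanSpace ℝ (Fin d)) (σ : Fin n → Fin k)
    (g : Fin n → Ω → EuclideanSpace ℝ (Fin d)) (ω : Ω) (i : Fin n) : EuclideanSpace ℝ (Fin d) :=
  μ (σ i) + g i ω

/-- The minimum separation of the centers (a minimum over a nonempty finite set if `2 ≤ k`). -/
def minSep {k d : ℕ} (μ : Fin k → EuclideanSpace ℝ (Fin d)) : ℝ :=
  ⨅ p : {p : Fin k × Fin k // p.1 ≠ p.2}, ‖μ p.1.1 - μ p.1.2‖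

/-- The signal-to-noise ratio. -/
def snr {k d : ℕ} (μ : Fin k → EuclideanSpace ℝ (Fin d)) (τ : ℝ) : ℝ :=
  minSep μ / τ

/-- The matrix of pairwise squared distances. -/
def sqDistMatrix {n d : ℕ} (h : Fin n → EuclideanSpace ℝ (Fin d)) :
    Matrix (Fin n) (Fin n) ℝ :=
  Matrix.of fun i j => ‖h i - h j‖ ^ 2

/-- Feasibility for the semidefinite program with `k` clusters. -/
structure IsFeasible {n : ℕ} (k : ℕ) (Y : Matrix (Fin n) (Fin n) ℝ) : Prop where
  rowSum : Matrix.mulVec Y (fun _ => 1) = fun _ => (n : ℝ) / (k : ℝ)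
  psd : Y.PosSemidef
  diag : ∀ i, Y i i = 1
  nonneg : ∀ i j, 0 ≤ Y i j

/-- `Y` is an optimal solution of the semidefinite program: it minimizes the trace inner product
with the matrix of squared distances over the feasible set. -/
def IsSDPSolution {n d : ℕ} (k : ℕ) (h : Fin n → EuclideanSpace ℝ (Fin d))
    (Y : Matrix (Fin n) (Fin n) ℝ) : Prop :=
  IsFeasible k Y ∧ ∀ Z : Matrix (Fin n) (Fin n) ℝ, IsFeasible k Z →
    (Y.transpose * sqDistMatrix h).trace ≤ (Z.transpose * sqDistMatrix h).trace

/-- The true cluster matrix. -/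
def trueClusterMatrix {n k : ℕ} (σ : Fin n → Fin k) : Matrix (Fin n) (Fin n) ℝ :=
  Matrix.of fun i j => if σ i = σ j then 1 else 0

/-- The entrywise `ℓ₁` norm. -/
def l1Norm {n : ℕ} (M : Matrix (Fin n) (Fin n) ℝ) : ℝ :=
  ∑ i, ∑ j, |M i j|

/-- Elementwise rounding to the nearest integer. -/
def roundMatrix {n : ℕ} (M : Matrix (Fin n) (Fin n) ℝ) : Matrix (Fin n) (Fin n) ℝ :=
  Matrix.of fun i j => ((round (M i j) : ℤ) : ℝ)

end SGMM

end

/-!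
Center the noise within each cluster, absorbing the cluster means of the noise into the centers.
Since the rows of a feasible `Y` have the same sums as those of the true cluster matrix, the
squared norms of the noise cancel in the excess of the objective, leaving the separation terms,
minus terms linear in the noise, minus the trace of `Y` against the Gram matrix of the centered
noise. Centering is a projection `P`, and `tr (P Y P)` is the cross-cluster mass of `Y` divided by
the cluster size. So the Gram term is at most that mass times `K / (n / k)`, where `K` bounds the
squared operator norm of the noise, while the separation terms are at least `Δ ^ 2` times the mass,
up to a constant.

The operator norm is bounded without nets: the exponential of the quadratic form is dominated by
its average over a ball, whose expectation is given by Tonelli's theorem. The inner product of a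
noise vector with the sum over a cluster is bounded by conditioning on that vector, whose own
square, if present in the sum, has the favorable sign. The terms linear in the noise can exceed a
quarter of the separation terms only where an exponential moment exceeds `exp (s ^ 2 / 4096)`, up to
a constant, and the sum of these moments is bounded by Chebyshev's inequality. Optimality of `Y`
then forces its cross-cluster mass, hence its `ℓ₁` error, to be exponentially small in `s ^ 2`.
-/

namespace SGMM

open scoped Finset InnerProductSpace

section Feasible

variable {n k : ℕ} {Y : Matrix (Fin n) (Fin n) ℝ}

lemma IsFeasible.symm (hY : IsFeasible k Y) (i j : Fin n) : Y i j = Y j i := by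
  simpa using hY.psd.1.apply j i

lemma IsFeasible.sum_row (hY : IsFeasible k Y) (i : Fin n) : ∑ j, Y i j = (n : ℝ) / k := by
  simpa [Matrix.mulVec, dotProduct] using congrFun hY.rowSum i

lemma IsFeasible.trace_eq (hY : IsFeasible k Y) : Y.trace = n := by
  simp [Matrix.trace, hY.diag]

lemma IsFeasible.le_one (hY : IsFeasible k Y) (i j : Fin n) : Y i j ≤ 1 := by
  have h := hY.psd.dotProduct_mulVec_nonneg (Pi.single i 1 - Pi.single j 1)
  simp only [star_trivial, Matrix.mulVec_sub, Matrix.mulVec_single, MulOpposite.op_one, one_smul,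
    dotProduct_sub, sub_dotProduct, single_dotProduct, Matrix.col_apply, hY.diag, mul_one,
    hY.symm j i, one_mul] at h
  linarith

lemma isClosed_setOf_isFeasible (n k : ℕ) :
    IsClosed {Y : Matrix (Fin n) (Fin n) ℝ | IsFeasible k Y} := by
  have h : {Y : Matrix (Fin n) (Fin n) ℝ | IsFeasible k Y} =
      {Y | Y.mulVec (fun _ => 1) = fun _ => (n : ℝ) / k} ∩
        ({Y | Y.conjTranspose = Y} ∩ ⋂ x : Fin n → ℝ, {Y | 0 ≤ star x ⬝ᵥ Y.mulVec x}) ∩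
        (⋂ i, {Y | Y i i = 1}) ∩ ⋂ i, ⋂ j, {Y | 0 ≤ Y i j} := by
    ext Y
    simp only [Set.mem_ofPred_eq, Set.mem_inter_iff, Set.mem_iInter]
    exact ⟨fun hY => ⟨⟨⟨hY.rowSum, hY.psd.1, hY.psd.dotProduct_mulVec_nonneg⟩, hY.diag⟩, hY.nonneg⟩,
      fun ⟨⟨⟨hrow, hherm, hquad⟩, hdiag⟩, hnonneg⟩ =>
        ⟨hrow, .of_dotProduct_mulVec_nonneg hherm hquad, hdiag, hnonneg⟩⟩
  rw [h]
  refine (((isClosed_eq (by fun_prop) continuous_const).inter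
    ((isClosed_eq (by fun_prop) continuous_id).inter (isClosed_iInter fun x => ?_))).inter
    (isClosed_iInter fun i => ?_)).inter (isClosed_iInter fun i => isClosed_iInter fun j => ?_)
  · exact isClosed_le continuous_const (by fun_prop)
  · exact isClosed_eq (by fun_prop) continuous_const
  · exact isClosed_le continuous_const (by fun_prop)

lemma isCompact_setOf_isFeasible (n k : ℕ) :
    IsCompact {Y : Matrix (Fin n) (Fin n) ℝ | IsFeasible k Y} := by
  have hbox : IsCompact (X := Matrix (Fin n) (Fin n) ℝ)
      (Set.univ.pi fun _ => Set.univ.pi fun _ => Set.Icc (0 : ℝ) 1) :=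
    isCompact_univ_pi fun _ => isCompact_univ_pi fun _ => isCompact_Icc
  exact hbox.of_isClosed_subset (isClosed_setOf_isFeasible n k)
    fun Y hY i _ j _ => ⟨hY.nonneg i j, hY.le_one i j⟩

lemma exists_isSDPSolution {d : ℕ} (h : Fin n → EuclideanSpace ℝ (Fin d))
    (hne : ∃ Z : Matrix (Fin n) (Fin n) ℝ, IsFeasible k Z) : ∃ Y, IsSDPSolution k h Y := by
  obtain ⟨Y, hY, hmin⟩ := (isCompact_setOf_isFeasible n k).exists_isMinOn hne
    (f := fun Z : Matrix (Fin n) (Fin n) ℝ => (Z.transpose * sqDistMatrix h).trace)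
    (by fun_prop)
  exact ⟨Y, hY, fun Z hZ => hmin hZ⟩

lemma trace_transpose_mul_sqDistMatrix {d : ℕ} (h : Fin n → EuclideanSpace ℝ (Fin d))
    (Y : Matrix (Fin n) (Fin n) ℝ) :
    (Y.transpose * sqDistMatrix h).trace = ∑ i, ∑ j, Y i j * ‖h i - h j‖ ^ 2 := by
  simp only [Matrix.trace, Matrix.diag, Matrix.mul_apply, Matrix.transpose_apply, sqDistMatrix,
    Matrix.of_apply]
  exact Finset.sum_comm

end Feasible

section Clusters

variable {n k : ℕ} {σ : Fin n → Fin k} {Y : Matrix (Fin n) (Fin n) ℝ}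

/-- The set of indices with label `a`. -/
abbrev cluster (σ : Fin n → Fin k) (a : Fin k) : Finset (Fin n) := {i | σ i = a}

lemma div_pos_of_label (σ : Fin n → Fin k) (i : Fin n) : 0 < (n : ℝ) / k := by
  have := i.pos
  have := (σ i).pos
  positivity

lemma sum_trueClusterMatrix_mul (σ : Fin n → Fin k) (f : Fin n → ℝ) (i : Fin n) :
    ∑ j, trueClusterMatrix σ i j * f j = ∑ j ∈ cluster σ (σ i), f j := by
  simp [trueClusterMatrix, Finset.sum_filter, eq_comm]

lemma trueClusterMatrix_isFeasible (hσ : ∀ a, (#(cluster σ a) : ℝ) = n / k) :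
    IsFeasible k (trueClusterMatrix σ) where
  rowSum := by
    ext i
    simpa [Matrix.mulVec, dotProduct, hσ] using sum_trueClusterMatrix_mul σ (fun _ => 1) i
  psd := by
    have : trueClusterMatrix σ =
        (Matrix.of fun (a : Fin k) i => if σ i = a then (1 : ℝ) else 0).conjTranspose *
          Matrix.of fun (a : Fin k) i => if σ i = a then (1 : ℝ) else 0 := by
      ext i j
      simp [trueClusterMatrix, Matrix.mul_apply, eq_comm]
    rw [this]
    exact Matrix.posSemidef_conjTranspose_mul_self _
  diag i := by simp [trueClusterMatrix]
  nonneg i j := by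
    simp only [trueClusterMatrix, Matrix.of_apply]
    split_ifs <;> norm_num

/-- The mass that `Y` puts on pairs of points from different clusters. It controls both the
`ℓ₁` distance of a feasible `Y` to the true cluster matrix and the excess of its objective. -/
def crossMass (σ : Fin n → Fin k) (Y : Matrix (Fin n) (Fin n) ℝ) : ℝ :=
  ∑ i, ∑ j, if σ i = σ j then 0 else Y i j

lemma IsFeasible.crossMass_nonneg (hY : IsFeasible k Y) : 0 ≤ crossMass σ Y := by
  refine Finset.sum_nonneg fun i _ => Finset.sum_nonneg fun j _ => ?_
  split_ifs
  exacts [le_rfl, hY.nonneg i j]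

lemma IsFeasible.l1Norm_sub_trueClusterMatrix (hY : IsFeasible k Y)
    (hσ : ∀ a, (#(cluster σ a) : ℝ) = n / k) :
    l1Norm (Y - trueClusterMatrix σ) = 2 * crossMass σ Y := by
  have habs i j : |(Y - trueClusterMatrix σ) i j| =
      2 * (if σ i = σ j then 0 else Y i j) - Y i j + trueClusterMatrix σ i j := by
    simp only [trueClusterMatrix, Matrix.sub_apply, Matrix.of_apply]
    split_ifs
    · rw [abs_of_nonpos (by linarith [hY.le_one i j])]; ring
    · rw [sub_zero, abs_of_nonneg (hY.nonneg i j)]; ring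
  simp only [l1Norm, crossMass, habs, Finset.sum_add_distrib, Finset.sum_sub_distrib, hY.sum_row,
    (trueClusterMatrix_isFeasible hσ).sum_row, Finset.mul_sum, sub_add_cancel]

lemma l1Norm_trueClusterMatrix (hσ : ∀ a, (#(cluster σ a) : ℝ) = n / k) :
    l1Norm (trueClusterMatrix σ) = n * (n / k) := by
  have hf := trueClusterMatrix_isFeasible hσ
  simp [l1Norm, abs_of_nonneg (hf.nonneg _ _), hf.sum_row]

lemma IsFeasible.trace_mul_trueClusterMatrix (hY : IsFeasible k Y) :
    (Y * trueClusterMatrix σ).trace = n * (n / k) - crossMass σ Y := by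
  have hentry i j : Y i j * trueClusterMatrix σ j i = Y i j - if σ i = σ j then 0 else Y i j := by
    simp only [trueClusterMatrix, Matrix.of_apply, eq_comm (a := σ j)]
    split_ifs <;> simp
  simp [Matrix.trace, Matrix.mul_apply, hentry, Finset.sum_sub_distrib, hY.sum_row, crossMass]

lemma sum_comp_eq_card_mul_sum {c : ℝ} (hσ : ∀ a, (#(cluster σ a) : ℝ) = c) (f : Fin k → ℝ) :
    ∑ j, f (σ j) = c * ∑ b, f b := by
  rw [← Finset.sum_fiberwise' Finset.univ σ f, Finset.mul_sum]
  simp only [Finset.sum_const, nsmul_eq_mul, hσ]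

end Clusters

section Gram

variable {ι E : Type*} [Fintype ι] [NormedAddCommGroup E] [InnerProductSpace ℝ E]

lemma norm_sq_sum_smul_le {K : ℝ} (hK0 : 0 ≤ K) {g : ι → E}
    (hK : ∀ u : E, ∑ i, ⟪g i, u⟫_ℝ ^ 2 ≤ K * ‖u‖ ^ 2) (x : ι → ℝ) :
    ‖∑ i, x i • g i‖ ^ 2 ≤ K * ∑ i, x i ^ 2 := by
  set w := ∑ i, x i • g i with hw
  have hself : ‖w‖ ^ 2 = ∑ i, x i * ⟪g i, w⟫_ℝ := by
    conv_lhs => rw [← real_inner_self_eq_norm_sq, hw, sum_inner]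
    simp only [real_inner_smul_left, ← hw]
  have hsq : (‖w‖ ^ 2) ^ 2 ≤ (∑ i, x i ^ 2) * (K * ‖w‖ ^ 2) := calc
    (‖w‖ ^ 2) ^ 2 ≤ (∑ i, x i ^ 2) * ∑ i, ⟪g i, w⟫_ℝ ^ 2 := by
      rw [hself]; exact Finset.sum_mul_sq_le_sq_mul_sq _ _ _
    _ ≤ (∑ i, x i ^ 2) * (K * ‖w‖ ^ 2) := by gcongr; exact hK w
  rcases (sq_nonneg ‖w‖).eq_or_lt with h0 | hpos
  · rw [← h0]; positivity
  · nlinarith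

lemma gram_sum_smul (M : Matrix ι ι ℝ) (g : ι → E) :
    Matrix.gram ℝ (fun i => ∑ j, M i j • g j) = M * Matrix.gram ℝ g * M.transpose := by
  ext i j
  simp only [Matrix.gram_apply, Matrix.mul_apply, Matrix.transpose_apply, sum_inner, inner_sum,
    real_inner_smul_left, real_inner_smul_right, Finset.sum_mul]
  exact Finset.sum_congr rfl fun _ _ => Finset.sum_congr rfl fun _ _ => by ring

open scoped MatrixOrder in
lemma trace_mul_nonneg {Z A : Matrix ι ι ℝ} (hZ : Z.PosSemidef) (hA : A.PosSemidef) :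
    0 ≤ (Z * A).trace := by
  classical
  obtain ⟨B, rfl⟩ := CStarAlgebra.nonneg_iff_eq_star_mul_self.mp hZ.nonneg
  rw [mul_assoc, Matrix.trace_mul_comm]
  exact (hA.mul_mul_conjTranspose_same B).trace_nonneg

lemma trace_mul_gram_le {K : ℝ} (hK0 : 0 ≤ K) {g : ι → E}
    (hK : ∀ u : E, ∑ i, ⟪g i, u⟫_ℝ ^ 2 ≤ K * ‖u‖ ^ 2) {Z : Matrix ι ι ℝ} (hZ : Z.PosSemidef) :
    (Z * Matrix.gram ℝ g).trace ≤ K * Z.trace := by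
  classical
  have hA : (K • (1 : Matrix ι ι ℝ) - Matrix.gram ℝ g).PosSemidef := by
    refine .of_dotProduct_mulVec_nonneg ?_ fun x => ?_
    · exact (Matrix.isHermitian_one.smul (IsSelfAdjoint.all K)).sub (Matrix.isHermitian_gram ℝ g)
    · rw [Matrix.sub_mulVec, dotProduct_sub, Matrix.star_dotProduct_gram_mulVec,
        real_inner_self_eq_norm_sq, sub_nonneg]
      simpa [Matrix.smul_mulVec, dotProduct, pow_two, mul_left_comm, Finset.mul_sum]
        using norm_sq_sum_smul_le hK0 hK x
  have h := trace_mul_nonneg hZ hA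
  rwa [mul_sub, Matrix.trace_sub, Matrix.mul_smul, Matrix.trace_smul, mul_one, smul_eq_mul,
    sub_nonneg] at h

end Gram

section Centering

variable {n k : ℕ} {σ : Fin n → Fin k} {Y : Matrix (Fin n) (Fin n) ℝ}
  {E : Type*} [NormedAddCommGroup E] [InnerProductSpace ℝ E]

/-- The mean of `g` over the cluster `a` (`0` if the cluster is empty). -/
noncomputable def clusterMean (σ : Fin n → Fin k) (g : Fin n → E) (a : Fin k) : E :=
  (#(cluster σ a) : ℝ)⁻¹ • ∑ j ∈ cluster σ a, g j

/-- The family `g`, centered within each cluster. -/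
noncomputable def clusterCentered (σ : Fin n → Fin k) (g : Fin n → E) (i : Fin n) : E :=
  g i - clusterMean σ g (σ i)

/-- The matrix of the map `g ↦ clusterCentered σ g` when all clusters have size `n / k`. -/
noncomputable def centeringMatrix (σ : Fin n → Fin k) : Matrix (Fin n) (Fin n) ℝ :=
  1 - ((n : ℝ) / k)⁻¹ • trueClusterMatrix σ

lemma sum_clusterCentered (σ : Fin n → Fin k) (g : Fin n → E) (a : Fin k) :
    ∑ j ∈ cluster σ a, clusterCentered σ g j = 0 := by
  have hmean : ∀ j ∈ cluster σ a, clusterCentered σ g j = g j - clusterMean σ g a :=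
    fun j hj => by rw [clusterCentered, (Finset.mem_filter.1 hj).2]
  rw [Finset.sum_congr rfl hmean, Finset.sum_sub_distrib, Finset.sum_const, clusterMean,
    ← Nat.cast_smul_eq_nsmul ℝ, smul_smul]
  rcases (cluster σ a).eq_empty_or_nonempty with h | h
  · simp [h]
  · rw [mul_inv_cancel₀ (by simpa using h.ne_empty), one_smul, sub_self]

lemma norm_sq_clusterMean_le {K : ℝ} (hK0 : 0 ≤ K) {g : Fin n → E}
    (hK : ∀ u : E, ∑ i, ⟪g i, u⟫_ℝ ^ 2 ≤ K * ‖u‖ ^ 2) (σ : Fin n → Fin k) (a : Fin k) :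
    ‖clusterMean σ g a‖ ^ 2 ≤ K / #(cluster σ a) := by
  set c : ℝ := (#(cluster σ a) : ℝ)⁻¹ with hc
  have hmean : clusterMean σ g a = ∑ i, (if σ i = a then c else 0) • g i := by
    simp [clusterMean, Finset.smul_sum, Finset.sum_filter, ite_smul, hc]
  calc ‖clusterMean σ g a‖ ^ 2
      ≤ K * ∑ i, (if σ i = a then c else 0) ^ 2 := hmean ▸ norm_sq_sum_smul_le hK0 hK _
    _ = K * (#(cluster σ a) * c ^ 2) := by simp [ite_pow, ← Finset.sum_filter]
    _ = K / #(cluster σ a) := by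
      rcases eq_or_ne (#(cluster σ a) : ℝ) 0 with h | h
      · simp [hc, h]
      · rw [hc]; field_simp

lemma sum_centeringMatrix_smul (hσ : ∀ a, (#(cluster σ a) : ℝ) = n / k) (g : Fin n → E)
    (i : Fin n) : ∑ j, centeringMatrix σ i j • g j = clusterCentered σ g i := by
  simp [centeringMatrix, Matrix.one_apply, trueClusterMatrix, sub_smul, Finset.sum_sub_distrib,
    ite_smul, clusterCentered, clusterMean, hσ, Finset.smul_sum, Finset.sum_filter, eq_comm]

lemma transpose_trueClusterMatrix (σ : Fin n → Fin k) :
    (trueClusterMatrix σ).transpose = trueClusterMatrix σ := by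
  ext i j
  simp [trueClusterMatrix, eq_comm]

lemma transpose_centeringMatrix (σ : Fin n → Fin k) :
    (centeringMatrix σ).transpose = centeringMatrix σ := by
  simp [centeringMatrix, transpose_trueClusterMatrix]

lemma trueClusterMatrix_mul_self (hσ : ∀ a, (#(cluster σ a) : ℝ) = n / k) :
    trueClusterMatrix σ * trueClusterMatrix σ = ((n : ℝ) / k) • trueClusterMatrix σ := by
  ext i j
  rw [Matrix.mul_apply, sum_trueClusterMatrix_mul σ (fun l => trueClusterMatrix σ l j) i]
  have : ∀ l ∈ cluster σ (σ i), trueClusterMatrix σ l j = trueClusterMatrix σ i j := by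
    intro l hl
    simp [trueClusterMatrix, (Finset.mem_filter.1 hl).2]
  simp [Finset.sum_congr rfl this, hσ]

lemma centeringMatrix_mul_self (hσ : ∀ a, (#(cluster σ a) : ℝ) = n / k) :
    centeringMatrix σ * centeringMatrix σ = centeringMatrix σ := by
  simp only [centeringMatrix, sub_mul, mul_sub, one_mul, mul_one, Matrix.smul_mul,
    Matrix.mul_smul, trueClusterMatrix_mul_self hσ, smul_smul]
  rcases eq_or_ne ((n : ℝ) / k) 0 with h | h
  · simp [h]
  · rw [inv_mul_cancel₀ h, mul_one, sub_self, sub_zero]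

lemma trace_mul_gram_clusterCentered_le {K : ℝ} (hK0 : 0 ≤ K) {g : Fin n → E}
    (hK : ∀ u : E, ∑ i, ⟪g i, u⟫_ℝ ^ 2 ≤ K * ‖u‖ ^ 2)
    (hσ : ∀ a, (#(cluster σ a) : ℝ) = n / k) (hY : IsFeasible k Y) :
    (Y * Matrix.gram ℝ (clusterCentered σ g)).trace ≤ K * (crossMass σ Y / (n / k)) := by
  rcases Nat.eq_zero_or_pos n with rfl | hn
  · simp [Matrix.trace, crossMass]
  have hm := div_pos_of_label σ ⟨0, hn⟩
  set P := centeringMatrix σ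
  have hPYP : (P * Y * P).PosSemidef := by
    simpa only [Matrix.conjTranspose_eq_transpose_of_trivial, P, transpose_centeringMatrix]
      using hY.psd.mul_mul_conjTranspose_same P
  calc (Y * Matrix.gram ℝ (clusterCentered σ g)).trace
      = (Y * (P * Matrix.gram ℝ g * P)).trace := by
        rw [← funext (sum_centeringMatrix_smul hσ g), gram_sum_smul, transpose_centeringMatrix]
    _ = (P * Y * P * Matrix.gram ℝ g).trace := by
        rw [← mul_assoc, Matrix.trace_mul_comm]; simp only [mul_assoc]
    _ ≤ K * (P * Y * P).trace := trace_mul_gram_le hK0 hK hPYP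
    _ = K * (Y * P).trace := by
        rw [Matrix.trace_mul_comm, ← mul_assoc, centeringMatrix_mul_self hσ, Matrix.trace_mul_comm]
    _ = K * (crossMass σ Y / (n / k)) := by
        simp only [P, centeringMatrix]
        rw [mul_sub, Matrix.trace_sub, mul_one, Matrix.mul_smul, Matrix.trace_smul, hY.trace_eq,
          hY.trace_mul_trueClusterMatrix, smul_eq_mul, mul_sub (_⁻¹),
          mul_comm (n : ℝ), inv_mul_cancel_left₀ hm.ne', sub_sub_cancel, inv_mul_eq_div]

end Centering

section Objective

variable {ι E : Type*} [Fintype ι] [NormedAddCommGroup E] [InnerProductSpace ℝ E]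

lemma sum_mul_norm_add_sub_add_sq {W : ι → ι → ℝ} (hsymm : ∀ i j, W i j = W j i)
    (hrow : ∀ i, ∑ j, W i j = 0) (p q : ι → E) :
    ∑ i, ∑ j, W i j * ‖(p i + q i) - (p j + q j)‖ ^ 2 =
      ∑ i, ∑ j, W i j * (‖p j - p i‖ ^ 2 - 4 * ⟪q i, p j - p i⟫_ℝ)
        - 2 * ∑ i, ∑ j, W i j * ⟪q i, q j⟫_ℝ := by
  set F : ι → ι → ℝ := fun i j => W i j * (2 * ⟪q i, p j - p i⟫_ℝ)
  set G : ι → ι → ℝ := fun i j => W i j * ‖q i‖ ^ 2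
  have hexpand i j : W i j * ‖(p i + q i) - (p j + q j)‖ ^ 2 =
      W i j * (‖p j - p i‖ ^ 2 - 4 * ⟪q i, p j - p i⟫_ℝ) - 2 * (W i j * ⟪q i, q j⟫_ℝ)
        + (F i j - F j i) + (G i j + G j i) := by
    have hsub : (p i + q i) - (p j + q j) = (p i - p j) + (q i - q j) := by abel
    simp only [F, G, hsymm j i]
    rw [hsub, norm_add_sq_real, norm_sub_sq_real (q i), norm_sub_rev (p i)]
    simp only [inner_sub_left, inner_sub_right, real_inner_comm (q _) (p _)]
    ring
  have hG : ∑ i, ∑ j, G i j = 0 :=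
    Finset.sum_eq_zero fun i _ => by rw [← Finset.sum_mul, hrow, zero_mul]
  have hF_comm : ∑ i, ∑ j, F j i = ∑ i, ∑ j, F i j := Finset.sum_comm
  have hG_comm : ∑ i, ∑ j, G j i = ∑ i, ∑ j, G i j := Finset.sum_comm
  simp only [hexpand, Finset.sum_add_distrib, Finset.sum_sub_distrib, ← Finset.mul_sum, hG,
    hF_comm, hG_comm]
  ring

variable {n k : ℕ} {σ : Fin n → Fin k} {Y : Matrix (Fin n) (Fin n) ℝ}

lemma trace_mul_gram (Y : Matrix ι ι ℝ) (q : ι → E) :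
    (Y * Matrix.gram ℝ q).trace = ∑ i, ∑ j, Y i j * ⟪q i, q j⟫_ℝ := by
  simp [Matrix.trace, Matrix.mul_apply, Matrix.gram_apply, real_inner_comm]

lemma objective_sub_eq (hσ : ∀ a, (#(cluster σ a) : ℝ) = n / k) (hY : IsFeasible k Y)
    (ν : Fin k → E) (g : Fin n → E) :
    ∑ i, ∑ j, (Y - trueClusterMatrix σ) i j *
        ‖(ν (σ i) + clusterCentered σ g i) - (ν (σ j) + clusterCentered σ g j)‖ ^ 2 =
      ∑ i, ∑ j, Y i j * (‖ν (σ j) - ν (σ i)‖ ^ 2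
        - 4 * ⟪clusterCentered σ g i, ν (σ j) - ν (σ i)⟫_ℝ)
      - 2 * (Y * Matrix.gram ℝ (clusterCentered σ g)).trace := by
  have hT := trueClusterMatrix_isFeasible hσ
  have hcenters i : ∑ j, trueClusterMatrix σ i j * (‖ν (σ j) - ν (σ i)‖ ^ 2
      - 4 * ⟪clusterCentered σ g i, ν (σ j) - ν (σ i)⟫_ℝ) = 0 := by
    rw [sum_trueClusterMatrix_mul]
    refine Finset.sum_eq_zero fun j hj => ?_
    simp [(Finset.mem_filter.1 hj).2]
  have hnoise i : ∑ j, trueClusterMatrix σ i j *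
      ⟪clusterCentered σ g i, clusterCentered σ g j⟫_ℝ = 0 := by
    rw [sum_trueClusterMatrix_mul, ← inner_sum, sum_clusterCentered, inner_zero_right]
  rw [sum_mul_norm_add_sub_add_sq (W := (Y - trueClusterMatrix σ))
    (fun i j => by simp [hY.symm i j, hT.symm i j])
    (fun i => by simp [hY.sum_row, hT.sum_row]) (fun i => ν (σ i)), trace_mul_gram]
  simp only [Matrix.sub_apply, sub_mul, Finset.sum_sub_distrib, hcenters, hnoise,
    sub_zero]

end Objective

section ExcessBound

variable {n k : ℕ} {σ : Fin n → Fin k} {Y : Matrix (Fin n) (Fin n) ℝ}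
  {E : Type*} [NormedAddCommGroup E] [InnerProductSpace ℝ E]

lemma inner_sum_erase_le_inner_sum {ι : Type*} [DecidableEq ι] (g : ι → E) (s : Finset ι) (i : ι) :
    ⟪g i, ∑ j ∈ s.erase i, g j⟫_ℝ ≤ ⟪g i, ∑ j ∈ s, g j⟫_ℝ := by
  by_cases hi : i ∈ s
  · rw [← Finset.add_sum_erase s g hi, inner_add_right]
    exact le_add_of_nonneg_left real_inner_self_nonneg
  · rw [Finset.erase_eq_of_notMem hi]

lemma neg_le_inner_clusterMean (hσ : ∀ a, (#(cluster σ a) : ℝ) = n / k) {g : Fin n → E} {i : Fin n}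
    {a : Fin k} {θ : ℝ} (h : |⟪g i, ∑ j ∈ (cluster σ a).erase i, g j⟫_ℝ| ≤ n / k * θ) :
    -θ ≤ ⟪g i, clusterMean σ g a⟫_ℝ := by
  rw [clusterMean, real_inner_smul_right, hσ, le_inv_mul_iff₀ (div_pos_of_label σ i), mul_neg]
  exact (neg_le_of_abs_le h).trans (inner_sum_erase_le_inner_sum g _ i)

lemma inner_clusterMean_le (hσ : ∀ a, (#(cluster σ a) : ℝ) = n / k) {g : Fin n → E} {i : Fin n}
    {a : Fin k} {θ : ℝ} (hia : σ i ≠ a)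
    (h : |⟪g i, ∑ j ∈ (cluster σ a).erase i, g j⟫_ℝ| ≤ n / k * θ) :
    ⟪g i, clusterMean σ g a⟫_ℝ ≤ θ := by
  rw [Finset.erase_eq_of_notMem (by simpa using hia)] at h
  rw [clusterMean, real_inner_smul_right, hσ, inv_mul_le_iff₀ (div_pos_of_label σ i)]
  exact le_of_abs_le h

lemma coefficient_lower_bound {Δ w : ℝ} {x v c c' : E} (hΔ : 0 < Δ) (hv : Δ ≤ ‖v‖)
    (hc : ‖c‖ ≤ Δ / 32) (hc' : ‖c'‖ ≤ Δ / 32)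
    (hxc : -(Δ ^ 2 / 64) ≤ ⟪x, c⟫_ℝ) (hxc' : ⟪x, c'⟫_ℝ ≤ Δ ^ 2 / 64)
    (hxv : 4 * ⟪x, v⟫_ℝ ≤ ‖v‖ ^ 2 / 4 + w) :
    5 / 16 * Δ ^ 2 - w ≤ ‖v + (c' - c)‖ ^ 2 - 4 * ⟪x - c, v + (c' - c)⟫_ℝ := by
  have hcc : ‖c' - c‖ ≤ Δ / 16 := (norm_sub_le _ _).trans (by linarith)
  have hlower : ‖v‖ - Δ / 16 ≤ ‖v + (c' - c)‖ := by
    have := norm_sub_le (v + (c' - c)) (c' - c)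
    rw [add_sub_cancel_right] at this
    linarith
  have hupper : ‖v + (c' - c)‖ ≤ ‖v‖ + Δ / 16 := (norm_add_le _ _).trans (by linarith)
  have hinner : -(Δ / 32 * (‖v‖ + Δ / 16)) ≤ ⟪c, v + (c' - c)⟫_ℝ := by
    refine neg_le_of_abs_le ((abs_real_inner_le_norm _ _).trans ?_)
    gcongr
  have hsq : (‖v‖ - Δ / 16) ^ 2 ≤ ‖v + (c' - c)‖ ^ 2 := pow_le_pow_left₀ (by linarith) hlower 2
  have hsplit : ⟪x - c, v + (c' - c)⟫_ℝ =
      ⟪x, v⟫_ℝ + ⟪x, c'⟫_ℝ - ⟪x, c⟫_ℝ - ⟪c, v + (c' - c)⟫_ℝ := by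
    rw [inner_sub_left, inner_add_right x, inner_sub_right x]
    ring
  rw [hsplit]
  nlinarith [mul_nonneg (sub_nonneg.2 hv) hΔ.le, mul_nonneg (sub_nonneg.2 hv) (hΔ.le.trans hv)]

variable {Δ K : ℝ} {μ : Fin k → E} {g : Fin n → E} {w : Fin n → Fin k → ℝ}

lemma sum_coefficient_lower_bound (hσ : ∀ a, (#(cluster σ a) : ℝ) = n / k) (hY : IsFeasible k Y)
    (hΔ : 0 < Δ) (hsep : ∀ a b, a ≠ b → Δ ≤ ‖μ b - μ a‖)
    (hmean : ∀ a, ‖clusterMean σ g a‖ ≤ Δ / 32)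
    (hcross : ∀ i a, |⟪g i, ∑ j ∈ (cluster σ a).erase i, g j⟫_ℝ| ≤ n / k * (Δ ^ 2 / 64))
    (hw : ∀ i b, 0 ≤ w i b)
    (hlin : ∀ i b, σ i ≠ b → 4 * ⟪g i, μ b - μ (σ i)⟫_ℝ ≤ ‖μ b - μ (σ i)‖ ^ 2 / 4 + w i b) :
    5 / 16 * Δ ^ 2 * crossMass σ Y - n / k * ∑ i, ∑ b, w i b ≤
      ∑ i, ∑ j, Y i j * (‖(μ + clusterMean σ g) (σ j) - (μ + clusterMean σ g) (σ i)‖ ^ 2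
        - 4 * ⟪clusterCentered σ g i,
          (μ + clusterMean σ g) (σ j) - (μ + clusterMean σ g) (σ i)⟫_ℝ) := by
  calc 5 / 16 * Δ ^ 2 * crossMass σ Y - n / k * ∑ i, ∑ b, w i b
      = ∑ i, ∑ j, (5 / 16 * Δ ^ 2 * (if σ i = σ j then 0 else Y i j) - w i (σ j)) := by
        simp only [crossMass, Finset.mul_sum, Finset.sum_sub_distrib, sum_comp_eq_card_mul_sum hσ]
    _ ≤ _ := by
        gcongr with i _ j _
        split_ifs with hij
        · simp [hij, hw]
        · have hcoeff := coefficient_lower_bound hΔ (hsep _ _ hij) (hmean (σ i)) (hmean (σ j))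
            (neg_le_inner_clusterMean hσ (hcross i _)) (inner_clusterMean_le hσ hij (hcross i _))
            (hlin i _ hij)
          rw [Pi.add_apply, Pi.add_apply, add_sub_add_comm]
          refine le_trans ?_ (mul_le_mul_of_nonneg_left hcoeff (hY.nonneg i j))
          nlinarith [hY.le_one i j, hw i (σ j)]

theorem crossMass_le (hσ : ∀ a, (#(cluster σ a) : ℝ) = n / k) (hY : IsFeasible k Y)
    (hΔ : 0 < Δ) (hsep : ∀ a b, a ≠ b → Δ ≤ ‖μ b - μ a‖) (hK0 : 0 ≤ K)
    (hK : ∀ u : E, ∑ i, ⟪g i, u⟫_ℝ ^ 2 ≤ K * ‖u‖ ^ 2) (hKΔ : K / (n / k) ≤ (Δ / 32) ^ 2)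
    (hcross : ∀ i a, |⟪g i, ∑ j ∈ (cluster σ a).erase i, g j⟫_ℝ| ≤ n / k * (Δ ^ 2 / 64))
    (hw : ∀ i b, 0 ≤ w i b)
    (hlin : ∀ i b, σ i ≠ b → 4 * ⟪g i, μ b - μ (σ i)⟫_ℝ ≤ ‖μ b - μ (σ i)‖ ^ 2 / 4 + w i b)
    (hopt : ∑ i, ∑ j, (Y - trueClusterMatrix σ) i j *
      ‖(μ (σ i) + g i) - (μ (σ j) + g j)‖ ^ 2 ≤ 0) :
    Δ ^ 2 / 4 * crossMass σ Y ≤ n / k * ∑ i, ∑ b, w i b := by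
  have hmean a : ‖clusterMean σ g a‖ ≤ Δ / 32 := by
    refine abs_le_of_sq_le_sq' ((norm_sq_clusterMean_le hK0 hK σ a).trans ?_) (by positivity) |>.2
    rwa [hσ]
  have hpoint i :
      μ (σ i) + g i = (μ + clusterMean σ g) (σ i) + clusterCentered σ g i := by
    simp [clusterCentered]
  simp only [hpoint, objective_sub_eq hσ hY] at hopt
  have hsignal := sum_coefficient_lower_bound hσ hY hΔ hsep hmean hcross hw hlin
  have hnoise : (Y * Matrix.gram ℝ (clusterCentered σ g)).trace ≤
      (Δ / 32) ^ 2 * crossMass σ Y := by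
    refine (trace_mul_gram_clusterCentered_le hK0 hK hσ hY).trans ?_
    rw [mul_div_left_comm, mul_comm]
    gcongr
    exact hY.crossMass_nonneg
  nlinarith [mul_nonneg (sq_nonneg Δ) (hY.crossMass_nonneg (σ := σ))]

end ExcessBound

section ExponentialMoments

lemma exp_le_add_exp_sq (x : ℝ) : Real.exp x ≤ x + Real.exp (x ^ 2) := by
  have h := Real.add_one_le_exp (x ^ 2)
  rcases le_or_gt |x| 1 with hx | hx
  · linarith [(abs_le.1 (Real.abs_exp_sub_one_sub_id_le hx)).2]
  rcases lt_abs.1 hx with hx | hx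
  · have : Real.exp x ≤ Real.exp (x ^ 2) := Real.exp_le_exp.2 (by nlinarith)
    linarith
  · have : Real.exp x ≤ 1 := Real.exp_le_one_iff.2 (by linarith)
    nlinarith

lemma two_mul_exp_le_exp_add_exp {a b c : ℝ} (h : 2 * a ≤ b + c) :
    2 * Real.exp a ≤ Real.exp b + Real.exp c := by
  have hmid : Real.exp a ≤ Real.exp (b / 2) * Real.exp (c / 2) := by
    rw [← Real.exp_add]
    exact Real.exp_le_exp.2 (by linarith)
  have hsq (x : ℝ) : Real.exp (x / 2) ^ 2 = Real.exp x := by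
    rw [← Real.exp_nat_mul, Nat.cast_two, mul_div_cancel₀ _ two_ne_zero]
  linarith [two_mul_le_add_sq (Real.exp (b / 2)) (Real.exp (c / 2)), hsq b, hsq c]

lemma ofReal_exp_rpow (x p : ℝ) :
    ENNReal.ofReal (Real.exp x) ^ p = ENNReal.ofReal (Real.exp (p * x)) := by
  rw [ENNReal.ofReal_rpow_of_pos (Real.exp_pos _), ← Real.exp_mul, mul_comm]

lemma two_rpow_le_ofReal_exp {p : ℝ} (hp : 0 ≤ p) :
    (2 : ℝ≥0∞) ^ p ≤ ENNReal.ofReal (Real.exp p) := by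
  have htwo : (2 : ℝ≥0∞) ≤ ENNReal.ofReal (Real.exp 1) := by
    rw [← ENNReal.ofReal_ofNat]
    exact ENNReal.ofReal_le_ofReal (by linarith [Real.add_one_le_exp (1 : ℝ)])
  simpa only [ofReal_exp_rpow, mul_one] using ENNReal.rpow_le_rpow htwo hp

variable {Ω : Type*} [MeasurableSpace Ω] {P : Measure Ω}

lemma lintegral_rpow_le_rpow_lintegral [IsProbabilityMeasure P] {f : Ω → ℝ≥0∞}
    (hf : AEMeasurable f P) {p : ℝ} (hp0 : 0 < p) (hp1 : p ≤ 1) :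
    ∫⁻ ω, f ω ^ p ∂P ≤ (∫⁻ ω, f ω ∂P) ^ p := by
  have h := eLpNorm'_le_eLpNorm'_of_exponent_le hp0 hp1 P hf.aestronglyMeasurable
  simp only [eLpNorm', enorm_eq_self, ENNReal.rpow_one, div_one] at h
  rwa [one_div, ENNReal.rpow_inv_le_iff hp0] at h

lemma lintegral_exp_mul_le_rpow [IsProbabilityMeasure P] {f : Ω → ℝ} (hf : AEMeasurable f P)
    {p : ℝ} (hp0 : 0 ≤ p) (hp1 : p ≤ 1) :
    ∫⁻ ω, ENNReal.ofReal (Real.exp (p * f ω)) ∂P ≤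
      (∫⁻ ω, ENNReal.ofReal (Real.exp (f ω)) ∂P) ^ p := by
  rcases hp0.eq_or_lt with rfl | hp0
  · simp
  simp_rw [← ofReal_exp_rpow]
  exact lintegral_rpow_le_rpow_lintegral (by fun_prop) hp0 hp1

lemma lintegral_exp_mul_le_exp [IsProbabilityMeasure P] {f : Ω → ℝ} (hf : AEMeasurable f P)
    (h2 : ∫⁻ ω, ENNReal.ofReal (Real.exp (f ω)) ∂P ≤ 2) {p : ℝ} (hp0 : 0 ≤ p) (hp1 : p ≤ 1) :
    ∫⁻ ω, ENNReal.ofReal (Real.exp (p * f ω)) ∂P ≤ ENNReal.ofReal (Real.exp p) :=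
  (lintegral_exp_mul_le_rpow hf hp0 hp1).trans
    ((ENNReal.rpow_le_rpow h2 hp0).trans (two_rpow_le_ofReal_exp hp0))

lemma integrable_exp_of_lintegral_ne_top {f : Ω → ℝ} (hf : AEMeasurable f P)
    (h : ∫⁻ ω, ENNReal.ofReal (Real.exp (f ω)) ∂P ≠ ∞) :
    Integrable (fun ω => Real.exp (f ω)) P :=
  lintegral_ofReal_ne_top_iff_integrable (by fun_prop) (ae_of_all _ fun _ => Real.exp_nonneg _)
    |>.1 h

lemma integral_exp_le_of_lintegral_le {f : Ω → ℝ} (hf : AEMeasurable f P) {a : ℝ} (ha : 0 ≤ a)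
    (h : ∫⁻ ω, ENNReal.ofReal (Real.exp (f ω)) ∂P ≤ ENNReal.ofReal a) :
    ∫ ω, Real.exp (f ω) ∂P ≤ a := by
  rw [integral_eq_lintegral_of_nonneg_ae (ae_of_all _ fun _ => Real.exp_nonneg _) (by fun_prop)]
  exact ENNReal.toReal_le_of_le_ofReal ha h

lemma integrable_of_lintegral_exp_norm_sq_ne_top {F : Type*} [NormedAddCommGroup F] {f : Ω → F}
    (hf : AEStronglyMeasurable f P)
    (h : ∫⁻ ω, ENNReal.ofReal (Real.exp (‖f ω‖ ^ 2)) ∂P ≠ ∞) : Integrable f P := by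
  refine (integrable_exp_of_lintegral_ne_top (hf.norm.aemeasurable.pow_const 2) h).mono' hf
    (ae_of_all _ fun ω => ?_)
  nlinarith [Real.add_one_le_exp (‖f ω‖ ^ 2), sq_nonneg (‖f ω‖ - 1)]

lemma measure_ofReal_exp_lt_le {f : Ω → ℝ≥0∞} (hf : AEMeasurable f P) {a : ℝ}
    (h : ∫⁻ ω, f ω ∂P ≤ ENNReal.ofReal (Real.exp a)) (x : ℝ) :
    P {ω | ENNReal.ofReal (Real.exp x) < f ω} ≤ ENNReal.ofReal (Real.exp (a - x)) := by
  rw [Real.exp_sub, ENNReal.ofReal_div_of_pos (Real.exp_pos _)]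
  calc P {ω | ENNReal.ofReal (Real.exp x) < f ω}
      ≤ P {ω | ENNReal.ofReal (Real.exp x) ≤ f ω} :=
        measure_mono (Set.ofPred_subset_ofPred.2 fun _ => le_of_lt)
    _ ≤ (∫⁻ ω, f ω ∂P) / ENNReal.ofReal (Real.exp x) :=
        meas_ge_le_lintegral_div hf (by simp [Real.exp_pos]) ENNReal.ofReal_ne_top
    _ ≤ _ := ENNReal.div_le_div_right h _

lemma lintegral_exp_mul_le_of_sq_le_one [IsProbabilityMeasure P] {X : Ω → ℝ}
    (hX : AEMeasurable X P) (h2 : ∫⁻ ω, ENNReal.ofReal (Real.exp (X ω ^ 2)) ∂P ≤ 2)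
    (h0 : ∫ ω, X ω ∂P = 0) {t : ℝ} (ht : t ^ 2 ≤ 1) :
    ∫⁻ ω, ENNReal.ofReal (Real.exp (t * X ω)) ∂P ≤ ENNReal.ofReal (Real.exp (t ^ 2)) := by
  have hsq := lintegral_exp_mul_le_exp (hX.pow_const 2) h2 (sq_nonneg t) ht
  have hsq_int : Integrable (fun ω => Real.exp (t ^ 2 * X ω ^ 2)) P :=
    integrable_exp_of_lintegral_ne_top (by fun_prop) (ne_top_of_le_ne_top ENNReal.ofReal_ne_top hsq)
  have hX_int : Integrable (fun ω => t * X ω) P :=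
    (integrable_of_lintegral_exp_norm_sq_ne_top hX.aestronglyMeasurable
      (ne_top_of_le_ne_top ENNReal.ofNat_ne_top (by simpa using h2))).const_mul t
  have hbound ω : Real.exp (t * X ω) ≤ t * X ω + Real.exp (t ^ 2 * X ω ^ 2) := by
    simpa only [mul_pow] using exp_le_add_exp_sq (t * X ω)
  have hexp_int : Integrable (fun ω => Real.exp (t * X ω)) P :=
    (hX_int.add hsq_int).mono' (by fun_prop) (ae_of_all _ fun ω => by
      simpa only [Real.norm_eq_abs, Real.abs_exp, Pi.add_apply] using hbound ω)
  rw [← ofReal_integral_eq_lintegral_ofReal hexp_int (ae_of_all _ fun _ => Real.exp_nonneg _)]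
  refine ENNReal.ofReal_le_ofReal ?_
  calc ∫ ω, Real.exp (t * X ω) ∂P
      ≤ ∫ ω, (t * X ω + Real.exp (t ^ 2 * X ω ^ 2)) ∂P :=
        integral_mono hexp_int (hX_int.add hsq_int) hbound
    _ = ∫ ω, Real.exp (t ^ 2 * X ω ^ 2) ∂P := by
        rw [integral_add hX_int hsq_int, integral_const_mul, h0, mul_zero, zero_add]
    _ ≤ Real.exp (t ^ 2) :=
        integral_exp_le_of_lintegral_le (by fun_prop) (Real.exp_nonneg _) hsq

lemma lintegral_exp_mul_le_of_one_le_sq [IsProbabilityMeasure P] {X : Ω → ℝ}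
    (hX : AEMeasurable X P) (h2 : ∫⁻ ω, ENNReal.ofReal (Real.exp (X ω ^ 2)) ∂P ≤ 2) {t : ℝ}
    (ht : 1 ≤ t ^ 2) :
    ∫⁻ ω, ENNReal.ofReal (Real.exp (t * X ω)) ∂P ≤ ENNReal.ofReal (Real.exp (t ^ 2)) := by
  have hpoint ω : ENNReal.ofReal (Real.exp (t * X ω)) ≤
      ENNReal.ofReal (Real.exp (t ^ 2 / 2)) * ENNReal.ofReal (Real.exp (1 / 2 * X ω ^ 2)) := by
    rw [← ENNReal.ofReal_mul (Real.exp_nonneg _), ← Real.exp_add]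
    exact ENNReal.ofReal_le_ofReal (Real.exp_le_exp.2 (by nlinarith [sq_nonneg (t - X ω)]))
  calc ∫⁻ ω, ENNReal.ofReal (Real.exp (t * X ω)) ∂P
      ≤ ENNReal.ofReal (Real.exp (t ^ 2 / 2)) *
          ∫⁻ ω, ENNReal.ofReal (Real.exp (1 / 2 * X ω ^ 2)) ∂P :=
        (lintegral_mono hpoint).trans_eq (lintegral_const_mul'' _ (by fun_prop))
    _ ≤ ENNReal.ofReal (Real.exp (t ^ 2 / 2)) * ENNReal.ofReal (Real.exp (1 / 2)) := by
        gcongr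
        exact lintegral_exp_mul_le_exp (by fun_prop) h2 (by norm_num) (by norm_num)
    _ ≤ ENNReal.ofReal (Real.exp (t ^ 2)) := by
        rw [← ENNReal.ofReal_mul (Real.exp_nonneg _), ← Real.exp_add]
        exact ENNReal.ofReal_le_ofReal (Real.exp_le_exp.2 (by linarith))

theorem hasSubgaussianMGF_of_lintegral_exp_sq_le [IsProbabilityMeasure P] {X : Ω → ℝ}
    (hX : AEMeasurable X P) (h2 : ∫⁻ ω, ENNReal.ofReal (Real.exp (X ω ^ 2)) ∂P ≤ 2)
    (h0 : ∫ ω, X ω ∂P = 0) : HasSubgaussianMGF X 2 P := by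
  have hmgf (t : ℝ) :
      ∫⁻ ω, ENNReal.ofReal (Real.exp (t * X ω)) ∂P ≤ ENNReal.ofReal (Real.exp (t ^ 2)) :=
    (le_total (t ^ 2) 1).elim (lintegral_exp_mul_le_of_sq_le_one hX h2 h0)
      (lintegral_exp_mul_le_of_one_le_sq hX h2)
  refine ⟨fun t => integrable_exp_of_lintegral_ne_top (by fun_prop)
    (ne_top_of_le_ne_top ENNReal.ofReal_ne_top (hmgf t)), fun t => ?_⟩
  rw [NNReal.coe_ofNat, mul_div_cancel_left₀ _ two_ne_zero]
  exact integral_exp_le_of_lintegral_le (by fun_prop) (Real.exp_nonneg _) (hmgf t)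

lemma lintegral_exp_le_of_hasSubgaussianMGF {X : Ω → ℝ} {c : NNReal}
    (hX : HasSubgaussianMGF X c P) :
    ∫⁻ ω, ENNReal.ofReal (Real.exp (X ω)) ∂P ≤ ENNReal.ofReal (Real.exp (c / 2)) := by
  have hint := hX.integrable_exp_mul 1
  have hmgf := hX.mgf_le 1
  simp only [mgf, one_mul, one_pow, mul_one] at hint hmgf
  rw [← ofReal_integral_eq_lintegral_ofReal hint (ae_of_all _ fun _ => Real.exp_nonneg _)]
  exact ENNReal.ofReal_le_ofReal hmgf

end ExponentialMoments

section BallAverage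

variable {E : Type*} [NormedAddCommGroup E] [InnerProductSpace ℝ E] [FiniteDimensional ℝ E]
  [MeasurableSpace E] [BorelSpace E]

lemma mul_measure_ball_le_setLIntegral {f : E → ℝ≥0∞} (hf : Measurable f) {u : E} {r R : ℝ}
    (hu : r + ‖u‖ ≤ R) (hmid : ∀ v, 2 * f u ≤ f (u + v) + f (u - v)) :
    f u * volume (Metric.ball (0 : E) r) ≤ ∫⁻ v in Metric.ball 0 R, f v := by
  have hsubset : Metric.ball u r ⊆ Metric.ball 0 R :=
    Metric.ball_subset_ball' (by rwa [dist_zero_right])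
  have hadd : ∫⁻ v in Metric.ball 0 r, f (u + v) ≤ ∫⁻ v in Metric.ball 0 R, f v := by
    have h := (measurePreserving_add_left volume u).setLIntegral_comp_preimage
      (s := Metric.ball u r) measurableSet_ball hf
    rw [show (u + ·) ⁻¹' Metric.ball u r = Metric.ball 0 r by ext; simp [dist_eq_norm]] at h
    exact h.trans_le (lintegral_mono_set hsubset)
  have hsub : ∫⁻ v in Metric.ball 0 r, f (u - v) ≤ ∫⁻ v in Metric.ball 0 R, f v := by
    have h := (Measure.measurePreserving_sub_left volume u).setLIntegral_comp_preimage
      (s := Metric.ball u r) measurableSet_ball hf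
    rw [show (u - ·) ⁻¹' Metric.ball u r = Metric.ball 0 r by ext; simp [dist_eq_norm]] at h
    exact h.trans_le (lintegral_mono_set hsubset)
  refine (ENNReal.mul_le_mul_iff_right two_ne_zero ENNReal.ofNat_ne_top).1 ?_
  calc 2 * (f u * volume (Metric.ball (0 : E) r))
      = ∫⁻ _ in Metric.ball (0 : E) r, 2 * f u := by rw [setLIntegral_const, mul_assoc]
    _ ≤ ∫⁻ v in Metric.ball 0 r, (f (u + v) + f (u - v)) := lintegral_mono hmid
    _ = (∫⁻ v in Metric.ball 0 r, f (u + v)) + ∫⁻ v in Metric.ball 0 r, f (u - v) :=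
        lintegral_add_left (by fun_prop) _
    _ ≤ 2 * ∫⁻ v in Metric.ball 0 R, f v := by rw [two_mul]; exact add_le_add hadd hsub

variable {ι : Type*} [Fintype ι] {T : ℝ}

/-- The average over the unit ball of `exp (∑ᵢ ⟨xᵢ, v⟩² / T²)`. It dominates the operator norm of
the family `x` and, unlike a supremum over `v`, its expectation is computed by Tonelli's theorem. -/
noncomputable def expAverage (T : ℝ) (x : ι → E) : ℝ≥0∞ :=
  ⨍⁻ v in Metric.ball (0 : E) 1, ENNReal.ofReal (Real.exp (∑ i, (⟪x i, v⟫_ℝ / T) ^ 2)) ∂volume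

lemma ofReal_exp_sum_inner_sq_le_expAverage (T : ℝ) (x : ι → E) {u : E} (hu : ‖u‖ ≤ 1 / 2) :
    ENNReal.ofReal (Real.exp (∑ i, (⟪x i, u⟫_ℝ / T) ^ 2)) ≤
      2 ^ Module.finrank ℝ E * expAverage T x := by
  set q : E → ℝ := fun v => ∑ i, (⟪x i, v⟫_ℝ / T) ^ 2 with hq
  have hmid (v : E) : 2 * ENNReal.ofReal (Real.exp (q u)) ≤
      ENNReal.ofReal (Real.exp (q (u + v))) + ENNReal.ofReal (Real.exp (q (u - v))) := by
    have hparallelogram : q (u + v) + q (u - v) = 2 * q u + 2 * q v := by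
      simp only [hq, inner_add_right, inner_sub_right, Finset.mul_sum, ← Finset.sum_add_distrib]
      exact Finset.sum_congr rfl fun i _ => by ring
    have hqv : 0 ≤ q v := Finset.sum_nonneg fun i _ => sq_nonneg _
    rw [← ENNReal.ofReal_add (Real.exp_nonneg _) (Real.exp_nonneg _), ← ENNReal.ofReal_ofNat,
      ← ENNReal.ofReal_mul zero_le_two]
    exact ENNReal.ofReal_le_ofReal (two_mul_exp_le_exp_add_exp (by linarith))
  have hball : volume (Metric.ball (0 : E) 1) =
      2 ^ Module.finrank ℝ E * volume (Metric.ball (0 : E) (1 / 2)) := by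
    have h := Measure.addHaar_ball_mul_of_pos volume (0 : E) two_pos (1 / 2)
    rwa [mul_one_div_cancel two_ne_zero, ENNReal.ofReal_pow zero_le_two, ENNReal.ofReal_ofNat] at h
  have hball0 : volume (Metric.ball (0 : E) 1) ≠ 0 :=
    (Metric.measure_ball_pos volume 0 one_pos).ne'
  have hmain := mul_measure_ball_le_setLIntegral (f := fun v => ENNReal.ofReal (Real.exp (q v)))
    (by fun_prop) (show 1 / 2 + ‖u‖ ≤ 1 by linarith) hmid
  rw [expAverage, setLAverage_eq, ← mul_div_assoc,
    ENNReal.le_div_iff_mul_le (Or.inl hball0) (Or.inl measure_ball_lt_top.ne), hball, mul_left_comm]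
  gcongr

variable {Ω : Type*} [MeasurableSpace Ω]

lemma measurable_expAverage {x : ι → Ω → E} (hx : ∀ i, Measurable (x i)) :
    Measurable fun ω => expAverage T fun i => x i ω := by
  simp only [expAverage, setLAverage_eq]
  refine Measurable.div_const (Measurable.lintegral_prod_right ?_) _
  fun_prop

end BallAverage

section SubGaussianVec

variable {E : Type*} [NormedAddCommGroup E] [InnerProductSpace ℝ E] {Ω : Type*}
  [MeasurableSpace Ω] {P : Measure Ω} {T : ℝ}

/-- The random vector `x` is sub-Gaussian at scale `T`: its marginals along vectors of norm at most
one satisfy the exponential-square bound that defines `psi2Norm`, with `t = T`. -/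
def SubGaussianVec (P : Measure Ω) (x : Ω → E) (T : ℝ) : Prop :=
  ∀ u : E, ‖u‖ ≤ 1 → ∫⁻ ω, ENNReal.ofReal (Real.exp ((⟪x ω, u⟫_ℝ / T) ^ 2)) ∂P ≤ 2

lemma lintegral_exp_inner_sq_le_of_psi2NormVec_le {d : ℕ} {τ : ℝ} (hT : 0 < T) (hτT : τ < T)
    {x : Ω → EuclideanSpace ℝ (Fin d)} (hx : psi2NormVec P x ≤ ENNReal.ofReal τ)
    {u : EuclideanSpace ℝ (Fin d)} (hu : ‖u‖ = 1) :
    ∫⁻ ω, ENNReal.ofReal (Real.exp ((⟪x ω, u⟫_ℝ / T) ^ 2)) ∂P ≤ 2 := by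
  have hnorm : psi2Norm P (fun ω => ⟪x ω, u⟫_ℝ) < ENNReal.ofReal T :=
    (le_iSup₂_of_le u (by simpa using hu) le_rfl).trans_lt
      (hx.trans_lt ((ENNReal.ofReal_lt_ofReal_iff hT).2 hτT))
  obtain ⟨_, ⟨t, ht0, rfl, ht⟩, htT⟩ := sInf_lt_iff.1 hnorm
  have htT : t < T := (ENNReal.ofReal_lt_ofReal_iff hT).1 htT
  refine (lintegral_mono fun ω => ENNReal.ofReal_le_ofReal (Real.exp_le_exp.2 ?_)).trans ht
  rw [div_pow]
  gcongr

lemma subGaussianVec_of_psi2NormVec_le [IsProbabilityMeasure P] {d : ℕ} {τ : ℝ} (hT : 0 < T)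
    (hτT : τ < T) {x : Ω → EuclideanSpace ℝ (Fin d)} (hx : psi2NormVec P x ≤ ENNReal.ofReal τ) :
    SubGaussianVec P x T := by
  intro u hu
  rcases eq_or_ne u 0 with rfl | hu0
  · simp
  have hpos : 0 < ‖u‖ := norm_pos_iff.2 hu0
  refine (lintegral_mono fun ω => ENNReal.ofReal_le_ofReal (Real.exp_le_exp.2 ?_)).trans
    (lintegral_exp_inner_sq_le_of_psi2NormVec_le hT hτT hx (norm_smul_inv_norm (𝕜 := ℝ) hu0))
  rw [real_inner_smul_right, mul_div_assoc, mul_pow]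
  exact le_mul_of_one_le_left (sq_nonneg _) (one_le_pow₀ ((one_le_inv₀ hpos).2 hu))

variable [MeasurableSpace E] [BorelSpace E]

lemma lintegral_exp_sum_inner_sq_le {ι : Type*} [Fintype ι] {g : ι → Ω → E}
    (hmeas : ∀ i, Measurable (g i)) (hind : iIndepFun g P) (hsub : ∀ i, SubGaussianVec P (g i) T)
    {u : E} (hu : ‖u‖ ≤ 1) :
    ∫⁻ ω, ENNReal.ofReal (Real.exp (∑ i, (⟪g i ω, u⟫_ℝ / T) ^ 2)) ∂P ≤ 2 ^ Fintype.card ι := by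
  have hind_exp := hind.comp (fun _ x => ENNReal.ofReal (Real.exp ((⟪x, u⟫_ℝ / T) ^ 2)))
    fun _ => by fun_prop
  calc ∫⁻ ω, ENNReal.ofReal (Real.exp (∑ i, (⟪g i ω, u⟫_ℝ / T) ^ 2)) ∂P
      = ∫⁻ ω, ∏ i, ENNReal.ofReal (Real.exp ((⟪g i ω, u⟫_ℝ / T) ^ 2)) ∂P := by
        simp_rw [Real.exp_sum, ENNReal.ofReal_prod_of_nonneg fun _ _ => Real.exp_nonneg _]
    _ = ∏ i, ∫⁻ ω, ENNReal.ofReal (Real.exp ((⟪g i ω, u⟫_ℝ / T) ^ 2)) ∂P :=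
        lintegral_prod_eq_prod_lintegral_of_indepFun Finset.univ _ hind_exp fun i => by
          have := hmeas i
          fun_prop
    _ ≤ ∏ _i : ι, 2 := Finset.prod_le_prod' fun i _ => hsub i u hu
    _ = 2 ^ Fintype.card ι := by rw [Finset.prod_const, Finset.card_univ]

variable [FiniteDimensional ℝ E]

lemma lintegral_expAverage_le [SFinite P] {ι : Type*} [Fintype ι] {g : ι → Ω → E}
    (hmeas : ∀ i, Measurable (g i)) (hind : iIndepFun g P)
    (hsub : ∀ i, SubGaussianVec P (g i) T) :
    ∫⁻ ω, expAverage T (fun i => g i ω) ∂P ≤ 2 ^ Fintype.card ι := by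
  have hmeas_exp : Measurable fun p : Ω × E =>
      ENNReal.ofReal (Real.exp (∑ i, (⟪g i p.1, p.2⟫_ℝ / T) ^ 2)) := by fun_prop
  simp only [expAverage, setLAverage_eq, div_eq_mul_inv (∫⁻ _, _ ∂_)]
  rw [lintegral_mul_const _ hmeas_exp.lintegral_prod_right,
    lintegral_lintegral_swap hmeas_exp.aemeasurable, ← div_eq_mul_inv]
  refine ENNReal.div_le_of_le_mul ?_
  rw [← setLIntegral_const]
  exact setLIntegral_mono measurable_const fun v hv =>
    lintegral_exp_sum_inner_sq_le hmeas hind hsub (mem_ball_zero_iff.1 hv).le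

lemma SubGaussianVec.lintegral_exp_norm_sq_le [IsProbabilityMeasure P] {x : Ω → E}
    (hmeas : Measurable x) (hsub : SubGaussianVec P x T) :
    ∫⁻ ω, ENNReal.ofReal (Real.exp ((‖x ω‖ / (2 * T)) ^ 2)) ∂P ≤ 2 ^ (1 + Module.finrank ℝ E) := by
  -- The operator norm of the one-element family `x ω` is `‖x ω‖`.
  have hle ω : ENNReal.ofReal (Real.exp ((‖x ω‖ / (2 * T)) ^ 2)) ≤
      2 ^ Module.finrank ℝ E * expAverage T fun _ : Unit => x ω := by
    have h := ofReal_exp_sum_inner_sq_le_expAverage T (fun _ : Unit => x ω)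
      (u := (2 * ‖x ω‖)⁻¹ • x ω) (by
        rw [norm_smul, norm_inv, norm_mul, norm_norm, Real.norm_ofNat, mul_inv, mul_assoc]
        linarith [inv_mul_le_one (a := ‖x ω‖)])
    rw [Fintype.sum_unique, real_inner_smul_right, real_inner_self_eq_norm_sq] at h
    have hscale : (2 * ‖x ω‖)⁻¹ * ‖x ω‖ ^ 2 / T = ‖x ω‖ / (2 * T) := by
      rw [sq, mul_inv, mul_assoc, ← mul_assoc (_⁻¹) (‖x ω‖), inv_mul_mul_self, inv_mul_eq_div,
        div_div]
    rwa [hscale] at h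
  refine (lintegral_mono hle).trans ?_
  rw [lintegral_const_mul _ (measurable_expAverage fun _ => hmeas), add_comm, pow_add, pow_one]
  gcongr
  exact (lintegral_expAverage_le (fun _ => hmeas) iIndepFun.of_subsingleton fun _ => hsub).trans_eq
    (by simp)

lemma SubGaussianVec.integrable [IsProbabilityMeasure P] {x : Ω → E} (hmeas : Measurable x)
    (hT : T ≠ 0) (hsub : SubGaussianVec P x T) : Integrable x P := by
  have hc : (2 * T)⁻¹ ≠ 0 := by positivity
  refine (integrable_smul_iff hc x).1 (integrable_of_lintegral_exp_norm_sq_ne_top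
    (by fun_prop) (ne_top_of_le_ne_top (by simp) (le_of_eq_of_le ?_
      (hsub.lintegral_exp_norm_sq_le hmeas))))
  simp only [Pi.smul_apply, norm_smul, norm_inv, mul_pow, div_pow, Real.norm_eq_abs,
    sq_abs, inv_mul_eq_div]

lemma SubGaussianVec.hasSubgaussianMGF_inner [IsProbabilityMeasure P] {x : Ω → E}
    (hmeas : Measurable x) (hT : T ≠ 0) (hsub : SubGaussianVec P x T) (h0 : ∫ ω, x ω ∂P = 0)
    (v : E) :
    HasSubgaussianMGF (fun ω => ⟪x ω, v⟫_ℝ) (Real.toNNReal (2 * (T * ‖v‖) ^ 2)) P := by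
  set e := ‖v‖⁻¹ • v
  have he : ‖e‖ ≤ 1 := by
    rw [norm_smul, norm_inv, norm_norm]
    exact inv_mul_le_one
  have hcentered : ∫ ω, ⟪x ω, e⟫_ℝ / T ∂P = 0 := by
    simp_rw [integral_div, real_inner_comm e]
    rw [integral_inner (hsub.integrable hmeas hT), h0, inner_zero_right, zero_div]
  have hunit := hasSubgaussianMGF_of_lintegral_exp_sq_le (by fun_prop) (hsub e he) hcentered
  convert! hunit.const_mul (T * ‖v‖) using 1
  · ext ω
    rcases eq_or_ne v 0 with rfl | hv
    · simp
    · have := norm_ne_zero_iff.2 hv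
      rw [real_inner_smul_right]
      field_simp
  · ext
    rw [Real.coe_toNNReal _ (by positivity)]
    exact mul_comm _ _

end SubGaussianVec

section TailBounds

variable {E : Type*} [NormedAddCommGroup E] [InnerProductSpace ℝ E] [FiniteDimensional ℝ E]
  [MeasurableSpace E] [BorelSpace E] {Ω : Type*} [MeasurableSpace Ω] {P : Measure Ω}
  [IsProbabilityMeasure P] {ι : Type*} {g : ι → Ω → E} {T : ℝ}

lemma sum_inner_sq_le_of_expAverage_le [Fintype ι] (hT : 0 < T) {x : ι → E} {a : ℝ}
    (hx : expAverage T x ≤ ENNReal.ofReal (Real.exp a)) (u : E) :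
    ∑ i, ⟪x i, u⟫_ℝ ^ 2 ≤ 4 * T ^ 2 * (a + Module.finrank ℝ E) * ‖u‖ ^ 2 := by
  rcases eq_or_ne u 0 with rfl | hu
  · simp
  have hhalf : ‖(2 * ‖u‖)⁻¹ • u‖ ≤ 1 / 2 := by
    rw [norm_smul, norm_inv, norm_mul, norm_norm, Real.norm_ofNat, mul_inv, mul_assoc]
    linarith [inv_mul_le_one (a := ‖u‖)]
  have hexp : ENNReal.ofReal (Real.exp (∑ i, (⟪x i, (2 * ‖u‖)⁻¹ • u⟫_ℝ / T) ^ 2)) ≤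
      ENNReal.ofReal (Real.exp (a + Module.finrank ℝ E)) := by
    calc _ ≤ 2 ^ Module.finrank ℝ E * expAverage T x :=
          ofReal_exp_sum_inner_sq_le_expAverage T x hhalf
      _ ≤ ENNReal.ofReal (Real.exp (Module.finrank ℝ E)) * ENNReal.ofReal (Real.exp a) := by
          gcongr
          simpa using two_rpow_le_ofReal_exp (Nat.cast_nonneg (Module.finrank ℝ E))
      _ = _ := by rw [← ENNReal.ofReal_mul (Real.exp_nonneg _), ← Real.exp_add, add_comm]
  have hsum := Real.exp_le_exp.1 ((ENNReal.ofReal_le_ofReal_iff (Real.exp_nonneg _)).1 hexp)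
  have hscale : ∑ i, (⟪x i, (2 * ‖u‖)⁻¹ • u⟫_ℝ / T) ^ 2 =
      (∑ i, ⟪x i, u⟫_ℝ ^ 2) / (4 * T ^ 2 * ‖u‖ ^ 2) := by
    rw [Finset.sum_div]
    refine Finset.sum_congr rfl fun i _ => ?_
    rw [real_inner_smul_right]
    field_simp
    ring
  rw [hscale, div_le_iff₀ (by positivity)] at hsum
  linarith

theorem measure_not_forall_sum_inner_sq_le_le [Fintype ι] (hmeas : ∀ i, Measurable (g i))
    (hind : iIndepFun g P) (hsub : ∀ i, SubGaussianVec P (g i) T) (hT : 0 < T) (a : ℝ) :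
    P {ω | ¬ ∀ u, ∑ i, ⟪g i ω, u⟫_ℝ ^ 2 ≤ 4 * T ^ 2 * (a + Module.finrank ℝ E) * ‖u‖ ^ 2} ≤
      ENNReal.ofReal (Real.exp (Fintype.card ι - a)) := by
  have hexp : ∫⁻ ω, expAverage T (fun i => g i ω) ∂P ≤
      ENNReal.ofReal (Real.exp (Fintype.card ι)) :=
    (lintegral_expAverage_le hmeas hind hsub).trans
      (by simpa using two_rpow_le_ofReal_exp (Nat.cast_nonneg (Fintype.card ι)))
  refine (measure_mono fun ω hω => ?_).trans
    (measure_ofReal_exp_lt_le (measurable_expAverage hmeas).aemeasurable hexp a)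
  exact not_le.1 fun h => hω (sum_inner_sq_le_of_expAverage_le hT h)

lemma lintegral_exp_inner_sum_le (hmeas : ∀ i, Measurable (g i)) (hind : iIndepFun g P)
    (hsub : ∀ i, SubGaussianVec P (g i) T) (hT : T ≠ 0) (h0 : ∀ i, ∫ ω, g i ω ∂P = 0)
    (S : Finset ι) (v : E) :
    ∫⁻ ω, ENNReal.ofReal (Real.exp ⟪∑ j ∈ S, g j ω, v⟫_ℝ) ∂P ≤
      ENNReal.ofReal (Real.exp (#S * T ^ 2 * ‖v‖ ^ 2)) := by
  have hsum := HasSubgaussianMGF.sum_of_iIndepFun (s := S)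
    (hind.comp (fun _ x => ⟪x, v⟫_ℝ) fun _ => by fun_prop)
    fun j _ => (hsub j).hasSubgaussianMGF_inner (hmeas j) hT (h0 j) v
  have hconst : (#S * T ^ 2 * ‖v‖ ^ 2 : ℝ) =
      ((∑ _j ∈ S, Real.toNNReal (2 * (T * ‖v‖) ^ 2) : NNReal) : ℝ) / 2 := by
    rw [Finset.sum_const, nsmul_eq_mul, NNReal.coe_mul, NNReal.coe_natCast,
      Real.coe_toNNReal _ (by positivity)]
    ring
  simp_rw [sum_inner]
  rw [hconst]
  exact lintegral_exp_le_of_hasSubgaussianMGF hsum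

lemma lintegral_exp_mul_inner_le_of_indepFun {X Y : Ω → E} (hX : Measurable X)
    (hY : Measurable Y) (hXY : IndepFun X Y P) {c : ℝ}
    (hmgf : ∀ v, ∫⁻ ω, ENNReal.ofReal (Real.exp ⟪Y ω, v⟫_ℝ) ∂P ≤
      ENNReal.ofReal (Real.exp (c * ‖v‖ ^ 2))) (t : ℝ) :
    ∫⁻ ω, ENNReal.ofReal (Real.exp (t * ⟪X ω, Y ω⟫_ℝ)) ∂P ≤
      ∫⁻ ω, ENNReal.ofReal (Real.exp (c * t ^ 2 * ‖X ω‖ ^ 2)) ∂P := by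
  have hpair := (indepFun_iff_map_prod_eq_prod_map_map hX.aemeasurable hY.aemeasurable).1 hXY
  have hmeas : Measurable fun p : E × E => ENNReal.ofReal (Real.exp (t * ⟪p.1, p.2⟫_ℝ)) := by
    fun_prop
  have hinner (x : E) : ∫⁻ y, ENNReal.ofReal (Real.exp (t * ⟪x, y⟫_ℝ)) ∂(P.map Y) ≤
      ENNReal.ofReal (Real.exp (c * t ^ 2 * ‖x‖ ^ 2)) := by
    rw [lintegral_map (by fun_prop) hY]
    simpa only [real_inner_smul_right, real_inner_comm, norm_smul, mul_pow, Real.norm_eq_abs,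
      sq_abs, mul_assoc] using hmgf (t • x)
  calc ∫⁻ ω, ENNReal.ofReal (Real.exp (t * ⟪X ω, Y ω⟫_ℝ)) ∂P
      = ∫⁻ x, ∫⁻ y, ENNReal.ofReal (Real.exp (t * ⟪x, y⟫_ℝ)) ∂(P.map Y) ∂(P.map X) := by
        rw [← lintegral_prod _ hmeas.aemeasurable, ← hpair, lintegral_map hmeas (hX.prodMk hY)]
    _ ≤ ∫⁻ x, ENNReal.ofReal (Real.exp (c * t ^ 2 * ‖x‖ ^ 2)) ∂(P.map X) := lintegral_mono hinner
    _ = _ := lintegral_map (by fun_prop) hX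

lemma lintegral_exp_mul_inner_sum_le (hmeas : ∀ i, Measurable (g i)) (hind : iIndepFun g P)
    (hsub : ∀ i, SubGaussianVec P (g i) T) (hT : T ≠ 0) (h0 : ∀ i, ∫ ω, g i ω ∂P = 0)
    {S : Finset ι} {i : ι} (hi : i ∉ S) {t : ℝ} (ht : 4 * (t * T ^ 2) ^ 2 * #S ≤ 1) :
    ∫⁻ ω, ENNReal.ofReal (Real.exp (t * ⟪g i ω, ∑ j ∈ S, g j ω⟫_ℝ)) ∂P ≤
      ENNReal.ofReal (Real.exp (4 * (t * T ^ 2) ^ 2 * #S * (1 + Module.finrank ℝ E))) := by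
  have hgi := hmeas i
  have hindep : IndepFun (g i) (fun ω => ∑ j ∈ S, g j ω) P := by
    simpa only [← Finset.sum_apply] using (hind.indepFun_finsetSum_of_notMem hmeas hi).symm
  calc ∫⁻ ω, ENNReal.ofReal (Real.exp (t * ⟪g i ω, ∑ j ∈ S, g j ω⟫_ℝ)) ∂P
      ≤ ∫⁻ ω, ENNReal.ofReal (Real.exp (#S * T ^ 2 * t ^ 2 * ‖g i ω‖ ^ 2)) ∂P :=
        lintegral_exp_mul_inner_le_of_indepFun hgi (by fun_prop) hindep
          (lintegral_exp_inner_sum_le hmeas hind hsub hT h0 S) t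
    _ = ∫⁻ ω, ENNReal.ofReal
          (Real.exp (4 * (t * T ^ 2) ^ 2 * #S * (‖g i ω‖ / (2 * T)) ^ 2)) ∂P := by
        refine lintegral_congr fun ω => ?_
        congr 2
        field_simp
        ring
    _ ≤ (2 ^ (1 + Module.finrank ℝ E)) ^ (4 * (t * T ^ 2) ^ 2 * #S) :=
        (lintegral_exp_mul_le_rpow (by fun_prop) (by positivity) ht).trans
          (ENNReal.rpow_le_rpow ((hsub i).lintegral_exp_norm_sq_le hgi) (by positivity))
    _ ≤ _ := by
        rw [← ENNReal.rpow_natCast, ← ENNReal.rpow_mul, mul_comm]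
        simpa using two_rpow_le_ofReal_exp
          (p := 4 * (t * T ^ 2) ^ 2 * #S * (1 + Module.finrank ℝ E : ℕ)) (by positivity)

theorem measure_abs_inner_sum_gt_le (hmeas : ∀ i, Measurable (g i)) (hind : iIndepFun g P)
    (hsub : ∀ i, SubGaussianVec P (g i) T) (hT : T ≠ 0) (h0 : ∀ i, ∫ ω, g i ω ∂P = 0)
    {S : Finset ι} {i : ι} (hi : i ∉ S) {t : ℝ} (ht0 : 0 < t)
    (ht : 4 * (t * T ^ 2) ^ 2 * #S ≤ 1) (θ : ℝ) :
    P {ω | θ < |⟪g i ω, ∑ j ∈ S, g j ω⟫_ℝ|} ≤ 2 * ENNReal.ofReal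
      (Real.exp (4 * (t * T ^ 2) ^ 2 * #S * (1 + Module.finrank ℝ E) - t * θ)) := by
  have hone_sided (s : ℝ) (hs : s ^ 2 = t ^ 2) :
      P {ω | ENNReal.ofReal (Real.exp (t * θ)) <
        ENNReal.ofReal (Real.exp (s * ⟪g i ω, ∑ j ∈ S, g j ω⟫_ℝ))} ≤ ENNReal.ofReal
          (Real.exp (4 * (t * T ^ 2) ^ 2 * #S * (1 + Module.finrank ℝ E) - t * θ)) := by
    have hst : (s * T ^ 2) ^ 2 = (t * T ^ 2) ^ 2 := by rw [mul_pow, mul_pow, hs]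
    rw [← hst] at ht ⊢
    have hgi := hmeas i
    exact measure_ofReal_exp_lt_le (by fun_prop)
      (lintegral_exp_mul_inner_sum_le hmeas hind hsub hT h0 hi ht) _
  rw [two_mul]
  refine (measure_mono fun ω hω => ?_).trans ((measure_union_le _ _).trans
    (add_le_add (hone_sided t rfl) (hone_sided (-t) (neg_sq t))))
  simp only [Set.mem_union, Set.mem_ofPred_eq, neg_mul, ← mul_neg, Real.exp_pos, Real.exp_lt_exp,
    ENNReal.ofReal_lt_ofReal_iff, mul_lt_mul_iff_right₀ ht0] at hω ⊢
  exact lt_abs.1 hω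

end TailBounds

section Chebyshev

variable {Ω : Type*} [MeasurableSpace Ω] {P : Measure Ω} [IsProbabilityMeasure P]

lemma integral_le_of_integral_sq_le {X : Ω → ℝ} (hX : MemLp X 2 P) {M : ℝ} (hM : 0 ≤ M)
    (hsq : ∫ ω, X ω ^ 2 ∂P ≤ M ^ 2) : ∫ ω, X ω ∂P ≤ M := by
  have hvar := variance_nonneg X P
  rw [variance_eq_sub hX] at hvar
  exact le_of_sq_le_sq (by simpa using (sub_nonneg.1 hvar).trans hsq) hM

theorem measure_sum_gt_le {ι : Type*} [Fintype ι] [Nonempty ι] {X : ι → Ω → ℝ}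
    (hX : ∀ i, MemLp (X i) 2 P) (hind : Pairwise fun i j => IndepFun (X i) (X j) P) {M : ℝ}
    (hM : 0 < M) (hsq : ∀ i, ∫ ω, X i ω ^ 2 ∂P ≤ M ^ 2) :
    P {ω | 3 * Fintype.card ι * M < ∑ i, X i ω} ≤
      ENNReal.ofReal (1 / (4 * Fintype.card ι)) := by
  set N : ℝ := (Fintype.card ι : ℝ)
  have hN : 0 < N := Nat.cast_pos.2 Fintype.card_pos
  have hvar : variance (∑ i, X i) P ≤ N * M ^ 2 := by
    rw [IndepFun.variance_sum (fun i _ => hX i) fun i _ j _ hij => hind hij]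
    calc ∑ i, variance (X i) P ≤ ∑ _i : ι, M ^ 2 := Finset.sum_le_sum fun i _ =>
          (variance_le_expectation_sq (hX i).aestronglyMeasurable).trans (hsq i)
      _ = N * M ^ 2 := by rw [Finset.sum_const, nsmul_eq_mul, Finset.card_univ]
  have hmean : ∫ ω, (∑ i, X i) ω ∂P ≤ N * M := by
    simp only [Finset.sum_apply]
    rw [integral_finsetSum _ fun i _ => (hX i).integrable one_le_two]
    calc ∑ i, ∫ ω, X i ω ∂P ≤ ∑ _i : ι, M := Finset.sum_le_sum fun i _ =>
          integral_le_of_integral_sq_le (hX i) hM.le (hsq i)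
      _ = N * M := by rw [Finset.sum_const, nsmul_eq_mul, Finset.card_univ]
  have hchebyshev := meas_ge_le_variance_div_sq (memLp_finsetSum' Finset.univ fun i _ => hX i)
    (show 0 < 2 * N * M by positivity)
  refine (measure_mono fun ω hω => ?_).trans
    (hchebyshev.trans (ENNReal.ofReal_le_ofReal ?_))
  · rw [Set.mem_ofPred_eq, ← Finset.sum_apply] at hω
    have hdev : 2 * N * M ≤ (∑ i, X i) ω - ∫ ω', (∑ i, X i) ω' ∂P := by linarith
    exact hdev.trans (le_abs_self _)
  · calc variance (∑ i, X i) P / (2 * N * M) ^ 2 ≤ N * M ^ 2 / (2 * N * M) ^ 2 := by gcongr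
      _ = 1 / (4 * N) := by field_simp; norm_num

end Chebyshev

section ExponentialSums

variable {E : Type*} [NormedAddCommGroup E] [InnerProductSpace ℝ E] [MeasurableSpace E]
  [BorelSpace E] {Ω : Type*} [MeasurableSpace Ω] {P : Measure Ω} {ι κ : Type*} [Fintype κ]
  {T : ℝ}

lemma sq_sum_exp_half_le (y : κ → ℝ) :
    (∑ b, Real.exp (y b / 2)) ^ 2 ≤ Fintype.card κ * ∑ b, Real.exp (y b) := by
  have hhalf b : Real.exp (y b / 2) ^ 2 = Real.exp (y b) := by
    rw [sq, ← Real.exp_add, add_halves]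
  simpa only [hhalf, Finset.card_univ] using
    sq_sum_le_card_mul_sum_sq (s := Finset.univ) (f := fun b => Real.exp (y b / 2))

lemma SubGaussianVec.integrable_exp_inner_sq {x : Ω → E} (hmeas : Measurable x)
    (hsub : SubGaussianVec P x T) {u : E} (hu : ‖u‖ ≤ 1) :
    Integrable (fun ω => Real.exp ((⟪x ω, u⟫_ℝ / T) ^ 2)) P :=
  integrable_exp_of_lintegral_ne_top (by fun_prop)
    (ne_top_of_le_ne_top ENNReal.ofNat_ne_top (hsub u hu))

lemma SubGaussianVec.integral_exp_inner_sq_le {x : Ω → E} (hmeas : Measurable x)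
    (hsub : SubGaussianVec P x T) {u : E} (hu : ‖u‖ ≤ 1) :
    ∫ ω, Real.exp ((⟪x ω, u⟫_ℝ / T) ^ 2) ∂P ≤ 2 :=
  integral_exp_le_of_lintegral_le (by fun_prop) zero_le_two (by simpa using hsub u hu)

variable {e : κ → E}

lemma SubGaussianVec.memLp_sum_exp {x : Ω → E} (hmeas : Measurable x)
    (hsub : SubGaussianVec P x T) (he : ∀ b, ‖e b‖ ≤ 1) :
    MemLp (fun ω => ∑ b, Real.exp ((⟪x ω, e b⟫_ℝ / T) ^ 2 / 2)) 2 P := by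
  have hmeas_sum : Measurable fun ω => ∑ b, Real.exp ((⟪x ω, e b⟫_ℝ / T) ^ 2 / 2) := by fun_prop
  refine (memLp_two_iff_integrable_sq hmeas_sum.aestronglyMeasurable).2 <|
    ((integrable_finsetSum Finset.univ fun b _ =>
      hsub.integrable_exp_inner_sq hmeas (he b)).const_mul (Fintype.card κ : ℝ)).mono'
    (hmeas_sum.pow_const 2).aestronglyMeasurable (ae_of_all _ fun ω => ?_)
  rw [Real.norm_of_nonneg (sq_nonneg _)]
  exact sq_sum_exp_half_le _

lemma SubGaussianVec.integral_sq_sum_exp_le {x : Ω → E} (hmeas : Measurable x)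
    (hsub : SubGaussianVec P x T) (he : ∀ b, ‖e b‖ ≤ 1) :
    ∫ ω, (∑ b, Real.exp ((⟪x ω, e b⟫_ℝ / T) ^ 2 / 2)) ^ 2 ∂P ≤ (2 * Fintype.card κ) ^ 2 := by
  have hint b := hsub.integrable_exp_inner_sq hmeas (he b)
  calc ∫ ω, (∑ b, Real.exp ((⟪x ω, e b⟫_ℝ / T) ^ 2 / 2)) ^ 2 ∂P
      ≤ ∫ ω, Fintype.card κ * ∑ b, Real.exp ((⟪x ω, e b⟫_ℝ / T) ^ 2) ∂P :=
        integral_mono (hsub.memLp_sum_exp hmeas he).integrable_sq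
          ((integrable_finsetSum _ fun b _ => hint b).const_mul _) fun ω => sq_sum_exp_half_le _
    _ = Fintype.card κ * ∑ b, ∫ ω, Real.exp ((⟪x ω, e b⟫_ℝ / T) ^ 2) ∂P := by
        rw [integral_const_mul, integral_finsetSum _ fun b _ => hint b]
    _ ≤ Fintype.card κ * ∑ _b : κ, 2 := by
        gcongr with b
        exact hsub.integral_exp_inner_sq_le hmeas (he b)
    _ ≤ (2 * Fintype.card κ) ^ 2 := by
        rw [Finset.sum_const, Finset.card_univ, nsmul_eq_mul]
        nlinarith [sq_nonneg (Fintype.card κ : ℝ)]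

theorem measure_sum_sum_exp_gt_le [IsProbabilityMeasure P] [Fintype ι] [Nonempty ι] [Nonempty κ]
    {g : ι → Ω → E} (hmeas : ∀ i, Measurable (g i)) (hind : iIndepFun g P)
    (hsub : ∀ i, SubGaussianVec P (g i) T) {e : ι → κ → E} (he : ∀ i b, ‖e i b‖ ≤ 1) :
    P {ω | 6 * Fintype.card ι * Fintype.card κ <
        ∑ i, ∑ b, Real.exp ((⟪g i ω, e i b⟫_ℝ / T) ^ 2 / 2)} ≤
      ENNReal.ofReal (1 / (4 * Fintype.card ι)) := by
  have hind_sum := hind.comp (fun i x => ∑ b, Real.exp ((⟪x, e i b⟫_ℝ / T) ^ 2 / 2))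
    fun i => by fun_prop
  convert! measure_sum_gt_le (fun i => (hsub i).memLp_sum_exp (hmeas i) (he i))
    (fun i j hij => hind_sum.indepFun hij) (M := 2 * Fintype.card κ)
    (by have := Fintype.card_pos (α := κ); positivity)
    (fun i => (hsub i).integral_sq_sum_exp_le (hmeas i) (he i)) using 5
  ring

end ExponentialSums

section NoiseBounds

variable {E : Type*} [NormedAddCommGroup E] [InnerProductSpace ℝ E] {n k : ℕ}
  {σ : Fin n → Fin k}

/-- The noise estimates from which recovery follows deterministically, for a noise sample `x` at
sub-Gaussian scale `T`: an operator norm bound, a bound `θ` on the inner products of a noise vector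
with the cluster sums of the other ones, and a bound on exponential moments along the directions
`e i b`. -/
structure NoiseBounds (σ : Fin n → Fin k) (x : Fin n → E) (e : Fin n → Fin k → E) (T θ : ℝ) :
    Prop where
  sum_inner_sq_le : ∀ u, ∑ i, ⟪x i, u⟫_ℝ ^ 2 ≤
    4 * T ^ 2 * (3 * n + Module.finrank ℝ E) * ‖u‖ ^ 2
  abs_inner_sum_erase_le : ∀ i a, |⟪x i, ∑ j ∈ (cluster σ a).erase i, x j⟫_ℝ| ≤ θ
  sum_exp_le : ∑ i, ∑ b, Real.exp ((⟪x i, e i b⟫_ℝ / T) ^ 2 / 2) ≤ 6 * n * k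

variable [FiniteDimensional ℝ E] [MeasurableSpace E] [BorelSpace E] {Ω : Type*}
  [MeasurableSpace Ω] {P : Measure Ω} [IsProbabilityMeasure P] {g : Fin n → Ω → E} {T : ℝ}

lemma measure_exists_abs_inner_sum_erase_gt_le (hmeas : ∀ i, Measurable (g i))
    (hind : iIndepFun g P) (hsub : ∀ i, SubGaussianVec P (g i) T) (hT : T ≠ 0)
    (h0 : ∀ i, ∫ ω, g i ω ∂P = 0) (hσ : ∀ a, (#(cluster σ a) : ℝ) = n / k) {t : ℝ} (ht0 : 0 < t)
    (ht : 4 * (t * T ^ 2) ^ 2 * (n / k) ≤ 1) (θ : ℝ) :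
    P {ω | ∃ i a, θ < |⟪g i ω, ∑ j ∈ (cluster σ a).erase i, g j ω⟫_ℝ|} ≤
      ENNReal.ofReal (n * k *
        (2 * Real.exp (4 * (t * T ^ 2) ^ 2 * (n / k) * (1 + Module.finrank ℝ E) - t * θ))) := by
  have hcard i a : (#((cluster σ a).erase i) : ℝ) ≤ n / k := by
    rw [← hσ a]
    exact_mod_cast Finset.card_erase_le
  have hpair (p : Fin n × Fin k) :
      P {ω | θ < |⟪g p.1 ω, ∑ j ∈ (cluster σ p.2).erase p.1, g j ω⟫_ℝ|} ≤ ENNReal.ofReal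
        (2 * Real.exp (4 * (t * T ^ 2) ^ 2 * (n / k) * (1 + Module.finrank ℝ E) - t * θ)) := by
    refine (measure_abs_inner_sum_gt_le hmeas hind hsub hT h0 (Finset.notMem_erase _ _) ht0
      (le_trans (by gcongr; exact hcard _ _) ht) θ).trans ?_
    rw [ENNReal.ofReal_mul zero_le_two, ENNReal.ofReal_ofNat]
    gcongr
    exact hcard _ _
  rw [show {ω | ∃ i a, θ < |⟪g i ω, ∑ j ∈ (cluster σ a).erase i, g j ω⟫_ℝ|} =
    ⋃ p : Fin n × Fin k, {ω | θ < |⟪g p.1 ω, ∑ j ∈ (cluster σ p.2).erase p.1, g j ω⟫_ℝ|} by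
      ext; simp]
  refine (measure_iUnion_fintype_le P _).trans ((Finset.sum_le_sum fun p _ => hpair p).trans_eq ?_)
  rw [Finset.sum_const, Finset.card_univ, Fintype.card_prod, Fintype.card_fin, Fintype.card_fin,
    nsmul_eq_mul, ← ENNReal.ofReal_natCast, ← ENNReal.ofReal_mul (Nat.cast_nonneg _), Nat.cast_mul]

theorem measure_not_noiseBounds_le (hn : 0 < n) (hmeas : ∀ i, Measurable (g i))
    (hind : iIndepFun g P) (hsub : ∀ i, SubGaussianVec P (g i) T) (hT : 0 < T)
    (h0 : ∀ i, ∫ ω, g i ω ∂P = 0) (hσ : ∀ a, (#(cluster σ a) : ℝ) = n / k)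
    {e : Fin n → Fin k → E} (he : ∀ i b, ‖e i b‖ ≤ 1) {t : ℝ} (ht0 : 0 < t)
    (ht : 4 * (t * T ^ 2) ^ 2 * (n / k) ≤ 1) (θ : ℝ) :
    P {ω | ¬ NoiseBounds σ (fun i => g i ω) e T θ} ≤ ENNReal.ofReal (Real.exp (-(2 * n)) + n * k *
      (2 * Real.exp (4 * (t * T ^ 2) ^ 2 * (n / k) * (1 + Module.finrank ℝ E) - t * θ)) +
      1 / (4 * n)) := by
  have : Nonempty (Fin n) := ⟨⟨0, hn⟩⟩
  have : Nonempty (Fin k) := this.map σ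
  have hoperator := measure_not_forall_sum_inner_sq_le_le hmeas hind hsub hT (3 * n)
  have hcross := measure_exists_abs_inner_sum_erase_gt_le hmeas hind hsub hT.ne' h0 hσ ht0 ht θ
  have hexp := measure_sum_sum_exp_gt_le hmeas hind hsub he
  rw [Fintype.card_fin, show (n : ℝ) - 3 * n = -(2 * n) by ring] at hoperator
  rw [Fintype.card_fin, Fintype.card_fin] at hexp
  rw [ENNReal.ofReal_add (by positivity) (by positivity),
    ENNReal.ofReal_add (by positivity) (by positivity)]
  refine (measure_mono fun ω hω => ?_).trans ((measure_union_le _ _).trans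
    (add_le_add ((measure_union_le _ _).trans (add_le_add hoperator hcross)) hexp))
  by_contra! hgood
  simp only [Set.mem_union, Set.mem_ofPred_eq, not_or, not_exists, not_lt] at hgood
  exact hω ⟨hgood.1.1, hgood.1.2, hgood.2⟩

end NoiseBounds

section Numerics

lemma exists_chernoff_parameter {m D β L : ℝ} (hm : 0 < m) (hD : 0 < D) (hβ : 0 < β)
    (hβD : 262144 * D * L ≤ β ^ 2 * m) (hβL : 1024 * L ≤ √m * β) :
    ∃ l : ℝ, 0 < l ∧ 4 * l ^ 2 * m ≤ 1 ∧ 4 * l ^ 2 * m * D - l * (m * β / 64) ≤ -(4 * L) := by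
  have hsq : √m ^ 2 = m := Real.sq_sqrt hm.le
  have hsuffices (l : ℝ) (hl0 : 0 < l) (hlD : l ≤ β / (512 * D)) (hlm : l ≤ 1 / (2 * √m))
      (hlL : 512 * L ≤ l * m * β) :
      0 < l ∧ 4 * l ^ 2 * m ≤ 1 ∧ 4 * l ^ 2 * m * D - l * (m * β / 64) ≤ -(4 * L) := by
    rw [le_div_iff₀ (by positivity)] at hlD hlm
    refine ⟨hl0, ?_, ?_⟩
    · calc 4 * l ^ 2 * m = (l * (2 * √m)) ^ 2 := by rw [mul_pow, mul_pow, hsq]; ring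
        _ ≤ 1 := pow_le_one₀ (by positivity) hlm
    · have hquadratic := mul_le_mul_of_nonneg_left hlD (show 0 ≤ l * m by positivity)
      linarith
  rcases le_total (β / (512 * D)) (1 / (2 * √m)) with h | h
  · refine ⟨β / (512 * D), hsuffices _ (by positivity) le_rfl h ?_⟩
    rw [div_mul_eq_mul_div, div_mul_eq_mul_div, le_div_iff₀ (by positivity)]
    linarith
  · refine ⟨1 / (2 * √m), hsuffices _ (by positivity) h le_rfl ?_⟩
    rw [show 1 / (2 * √m) * m * β = √m * β / 2 by field_simp; rw [hsq]]
    linarith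

lemma log_le_two_mul_sqrt {x : ℝ} (hx : 0 < x) : Real.log x ≤ 2 * √x := by
  have h := Real.log_le_sub_one_of_pos (Real.sqrt_pos.2 hx)
  rw [Real.log_sqrt hx.le] at h
  linarith

lemma log_le_mul_sqrt_div {n k : ℝ} (hn : 0 < n) (hk : 1 ≤ k) :
    Real.log n ≤ 2 * (k * √(n / k)) := by
  have hsqrt : √n ≤ k * √(n / k) := by
    rw [Real.sqrt_le_left (by positivity), mul_pow, Real.sq_sqrt (by positivity), sq, mul_assoc,
      mul_div_cancel₀ _ (by positivity)]
    exact le_mul_of_one_le_left hn.le hk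
  linarith [log_le_two_mul_sqrt hn]

lemma dimension_mul_log_le {n k d s : ℝ} (hn : 1 ≤ n) (hk : 1 ≤ k) (hd : 0 ≤ d)
    (hs : 100000 * (√(k * d / n * Real.log n) + k * d / n + k) ≤ s ^ 2) :
    262144 * (1 + d) * Real.log n ≤ (s ^ 2 / 4) ^ 2 * (n / k) := by
  have hL : 0 ≤ Real.log n := Real.log_nonneg hn
  have hratio : 0 ≤ k * d / n := by positivity
  have hdim : 100000 ^ 2 * (d * Real.log n) ≤ (s ^ 2) ^ 2 * (n / k) := by
    calc 100000 ^ 2 * (d * Real.log n)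
        = (100000 * √(k * d / n * Real.log n)) ^ 2 * (n / k) := by
          rw [mul_pow, Real.sq_sqrt (by positivity)]
          field_simp
      _ ≤ (s ^ 2) ^ 2 * (n / k) := by
          gcongr
          linarith
  have hclusters : 100000 ^ 2 * Real.log n ≤ (s ^ 2) ^ 2 * (n / k) := by
    calc 100000 ^ 2 * Real.log n ≤ 100000 ^ 2 * (k * n) := by
          gcongr
          nlinarith [Real.log_le_sub_one_of_pos (zero_lt_one.trans_le hn)]
      _ = (100000 * k) ^ 2 * (n / k) := by field_simp
      _ ≤ (s ^ 2) ^ 2 * (n / k) := by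
          gcongr
          linarith [Real.sqrt_nonneg (k * d / n * Real.log n)]
  nlinarith [mul_nonneg hd hL]

lemma exists_cross_term_parameter {n k d s : ℝ} (hn : 1 ≤ n) (hk : 1 ≤ k) (hd : 0 ≤ d)
    (hs : 100000 * (√(k * d / n * Real.log n) + k * d / n + k) ≤ s ^ 2) :
    ∃ l : ℝ, 0 < l ∧ 4 * l ^ 2 * (n / k) ≤ 1 ∧
      4 * l ^ 2 * (n / k) * (1 + d) - l * (n / k * (s ^ 2 / 4) / 64) ≤ -(4 * Real.log n) := by
  have hsk : 100000 * k ≤ s ^ 2 := by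
    have : 0 ≤ k * d / n := by positivity
    linarith [Real.sqrt_nonneg (k * d / n * Real.log n)]
  refine exists_chernoff_parameter (by positivity) (by positivity) (by linarith)
    (dimension_mul_log_le hn hk hd hs) ?_
  calc 1024 * Real.log n ≤ 1024 * (2 * (k * √(n / k))) := by
        gcongr
        exact log_le_mul_sqrt_div (zero_lt_one.trans_le hn) hk
    _ = √(n / k) * (2048 * k) := by ring
    _ ≤ √(n / k) * (s ^ 2 / 4) := by
        gcongr
        linarith

lemma exp_neg_natCast_mul_log (p : ℕ) {x : ℝ} (hx : 0 < x) :
    Real.exp (-(p * Real.log x)) = (x ^ p)⁻¹ := by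
  rw [Real.exp_neg, Real.exp_nat_mul, Real.exp_log hx]

lemma failure_probability_le {n k : ℝ} (hn : 2 ≤ n) (hkn : k ≤ n) :
    Real.exp (-(2 * n)) + n * k * (2 * Real.exp (-(4 * Real.log n))) + 1 / (4 * n) ≤ 2 / n := by
  have hn0 : 0 < n := by linarith
  have hoperator : Real.exp (-(2 * n)) ≤ 1 / (2 * n) := by
    rw [Real.exp_neg, ← one_div]
    exact one_div_le_one_div_of_le (by positivity) (by linarith [Real.add_one_le_exp (2 * n)])
  have hcross : n * k * (2 * Real.exp (-(4 * Real.log n))) ≤ 1 / n := by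
    rw [show Real.exp (-(4 * Real.log n)) = (n ^ 4)⁻¹ by
      simpa using exp_neg_natCast_mul_log 4 hn0]
    calc n * k * (2 * (n ^ 4)⁻¹) ≤ n * n * (n * (n ^ 4)⁻¹) := by gcongr
      _ = 1 / n := by field_simp
  calc _ ≤ 1 / (2 * n) + 1 / n + 1 / (4 * n) := by gcongr
    _ ≤ 2 / n := by
      field_simp
      norm_num

end Numerics

section GoodEvent

variable {E : Type*} [NormedAddCommGroup E] [InnerProductSpace ℝ E] {Ω : Type*}
  [MeasurableSpace Ω] {P : Measure Ω} [IsProbabilityMeasure P] {n k : ℕ} {σ : Fin n → Fin k}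

lemma exists_measurableSet_of_measure_not_le {p : Ω → Prop} {ε : ℝ} (hε : 0 ≤ ε)
    (h : P {ω | ¬ p ω} ≤ ENNReal.ofReal ε) :
    ∃ A : Set Ω, MeasurableSet A ∧ 1 - ε ≤ P.real A ∧ ∀ ω ∈ A, p ω := by
  have hB : MeasurableSet (toMeasurable P {ω | ¬ p ω}) := measurableSet_toMeasurable _ _
  refine ⟨_, hB.compl, ?_, fun ω hω => not_not.1 fun hp => hω (subset_toMeasurable _ _ hp)⟩
  rw [probReal_compl_eq_one_sub hB]
  gcongr
  exact ENNReal.toReal_le_of_le_ofReal hε ((measure_toMeasurable _).trans_le h)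

lemma le_of_card_cluster (hσ : ∀ a, (#(cluster σ a) : ℝ) = n / k) (hn : 0 < n) : k ≤ n := by
  have hsurj : Function.Surjective σ := fun a => by
    have hpos : (0 : ℝ) < #(cluster σ a) := by
      rw [hσ]
      exact div_pos_of_label σ ⟨0, hn⟩
    obtain ⟨i, hi⟩ := Finset.card_pos.1 (Nat.cast_pos.1 hpos)
    exact ⟨i, by simpa using hi⟩
  simpa using Fintype.card_le_of_surjective σ hsurj

variable [FiniteDimensional ℝ E] [MeasurableSpace E] [BorelSpace E] {g : Fin n → Ω → E} {T : ℝ}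

theorem exists_event_noiseBounds (hn : 2 ≤ n) (hmeas : ∀ i, Measurable (g i))
    (hind : iIndepFun g P) (hsub : ∀ i, SubGaussianVec P (g i) T) (hT : 0 < T)
    (h0 : ∀ i, ∫ ω, g i ω ∂P = 0) (hσ : ∀ a, (#(cluster σ a) : ℝ) = n / k)
    {e : Fin n → Fin k → E} (he : ∀ i b, ‖e i b‖ ≤ 1) {s : ℝ}
    (hs : 100000 * (√(k * Module.finrank ℝ E / n * Real.log n) + k * Module.finrank ℝ E / n + k) ≤
      s ^ 2) :
    ∃ A : Set Ω, MeasurableSet A ∧ 1 - 2 / (n : ℝ) ≤ P.real A ∧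
      ∀ ω ∈ A, NoiseBounds σ (fun i => g i ω) e T (n / k * ((s * T / 2) ^ 2 / 64)) := by
  have hk : 1 ≤ k := Fin.pos (σ ⟨0, by omega⟩)
  obtain ⟨l, hl0, hl, hexponent⟩ := exists_cross_term_parameter (n := n) (k := k)
    (by exact_mod_cast one_le_two.trans hn) (by exact_mod_cast hk) (Nat.cast_nonneg _) hs
  refine exists_measurableSet_of_measure_not_le (by positivity) ?_
  have hscale : l / T ^ 2 * T ^ 2 = l := div_mul_cancel₀ _ (by positivity)
  have hthreshold : l / T ^ 2 * (n / k * ((s * T / 2) ^ 2 / 64)) =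
      l * (n / k * (s ^ 2 / 4) / 64) := by
    field_simp
    ring
  refine (measure_not_noiseBounds_le (by omega) hmeas hind hsub hT h0 hσ he
    (t := l / T ^ 2) (by positivity) (by rwa [hscale]) _).trans (ENNReal.ofReal_le_ofReal ?_)
  rw [hscale, hthreshold]
  refine le_trans ?_ (failure_probability_le (n := n) (k := k) (by exact_mod_cast hn)
    (by exact_mod_cast le_of_card_cluster hσ (by omega)))
  gcongr

end GoodEvent

section Recovery

lemma linear_term_le {D T s x : ℝ} (hT : 0 < T) (hD : 0 < D) (hs : 0 ≤ s) (hsD : s * T ≤ 2 * D) :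
    4 * (D * (T * x)) ≤
      D ^ 2 / 4 + 256 * T ^ 2 * Real.exp (-(s ^ 2 / 4096)) * Real.exp (x ^ 2 / 2) := by
  rcases le_or_gt (16 * (T * x)) D with hx | hx
  · have hsmall := mul_le_mul_of_nonneg_left hx hD.le
    have hweight : 0 ≤ 256 * T ^ 2 * Real.exp (-(s ^ 2 / 4096)) * Real.exp (x ^ 2 / 2) := by
      positivity
    linarith
  · have hsx : s ≤ 32 * x := le_of_mul_le_mul_right (by linarith) hT
    have hexp : x ^ 2 / 4 ≤ Real.exp (-(s ^ 2 / 4096) + x ^ 2 / 2) := by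
      nlinarith [Real.add_one_le_exp (-(s ^ 2 / 4096) + x ^ 2 / 2)]
    rw [mul_assoc, ← Real.exp_add]
    calc 4 * (D * (T * x)) ≤ 4 * (16 * (T * x) * (T * x)) := by
          have : 0 ≤ T * x := by linarith
          gcongr
      _ = 256 * T ^ 2 * (x ^ 2 / 4) := by ring
      _ ≤ 256 * T ^ 2 * Real.exp (-(s ^ 2 / 4096) + x ^ 2 / 2) := by gcongr
      _ ≤ _ := le_add_of_nonneg_left (by positivity)

lemma four_mul_inner_le {E : Type*} [NormedAddCommGroup E] [InnerProductSpace ℝ E] {x v : E}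
    {T s : ℝ} (hT : 0 < T) (hv : v ≠ 0) (hs : 0 ≤ s) (hsv : s * T ≤ 2 * ‖v‖) :
    4 * ⟪x, v⟫_ℝ ≤ ‖v‖ ^ 2 / 4 + 256 * T ^ 2 * Real.exp (-(s ^ 2 / 4096)) *
      Real.exp ((⟪x, ‖v‖⁻¹ • v⟫_ℝ / T) ^ 2 / 2) := by
  have hpos := norm_pos_iff.2 hv
  convert! linear_term_le hT hpos hs hsv (x := ⟪x, ‖v‖⁻¹ • v⟫_ℝ / T) using 2
  rw [mul_div_cancel₀ _ hT.ne', real_inner_smul_right, mul_inv_cancel_left₀ hpos.ne']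

variable {n k d : ℕ} {μ : Fin k → EuclideanSpace ℝ (Fin d)} {σ : Fin n → Fin k} {τ : ℝ}

/-- The unit vector pointing from the center of the `i`-th point to the `b`-th center, along which
the noise of that point has to be controlled; it is zero when the two centers coincide. -/
noncomputable def centerDirection {E : Type*} [NormedAddCommGroup E] [NormedSpace ℝ E]
    (μ : Fin k → E) (σ : Fin n → Fin k) (i : Fin n) (b : Fin k) : E :=
  ‖μ b - μ (σ i)‖⁻¹ • (μ b - μ (σ i))

lemma norm_centerDirection_le_one {E : Type*} [NormedAddCommGroup E] [NormedSpace ℝ E]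
    (μ : Fin k → E) (σ : Fin n → Fin k) (i : Fin n) (b : Fin k) :
    ‖centerDirection μ σ i b‖ ≤ 1 := by
  rw [centerDirection, norm_smul, norm_inv, norm_norm]
  exact inv_mul_le_one

lemma minSep_le (μ : Fin k → EuclideanSpace ℝ (Fin d)) {a b : Fin k} (hab : a ≠ b) :
    minSep μ ≤ ‖μ b - μ a‖ := by
  rw [norm_sub_rev]
  exact ciInf_le (f := fun p : {p : Fin k × Fin k // p.1 ≠ p.2} => ‖μ p.1.1 - μ p.1.2‖)
    (Set.finite_range _).bddBelow ⟨(a, b), hab⟩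

lemma minSep_nonneg (μ : Fin k → EuclideanSpace ℝ (Fin d)) : 0 ≤ minSep μ :=
  Real.iInf_nonneg fun _ => norm_nonneg _

lemma snr_mul_self (μ : Fin k → EuclideanSpace ℝ (Fin d)) (hτ : τ ≠ 0) :
    snr μ τ * τ = minSep μ :=
  div_mul_cancel₀ _ hτ

lemma IsSDPSolution.sum_sub_trueClusterMatrix_mul_nonpos
    {h : Fin n → EuclideanSpace ℝ (Fin d)} {Y : Matrix (Fin n) (Fin n) ℝ}
    (hY : IsSDPSolution k h Y) (hσ : ∀ a, (#(cluster σ a) : ℝ) = n / k) :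
    ∑ i, ∑ j, (Y - trueClusterMatrix σ) i j * ‖h i - h j‖ ^ 2 ≤ 0 := by
  have hle := hY.2 _ (trueClusterMatrix_isFeasible hσ)
  simpa only [trace_transpose_mul_sqDistMatrix, Matrix.sub_apply, sub_mul,
    Finset.sum_sub_distrib, sub_nonpos] using hle

variable {x : Fin n → EuclideanSpace ℝ (Fin d)} {Y : Matrix (Fin n) (Fin n) ℝ}

lemma NoiseBounds.crossMass_le (hσ : ∀ a, (#(cluster σ a) : ℝ) = n / k) (hτ : 0 < τ)
    (hΔ : 0 < minSep μ) (hs : 16384 * (k * d / n + 3 * k) ≤ snr μ τ ^ 2)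
    (hx : NoiseBounds σ x (centerDirection μ σ) (2 * τ) (n / k * (minSep μ ^ 2 / 64)))
    (hY : IsSDPSolution k (fun i => μ (σ i) + x i) Y) :
    minSep μ ^ 2 / 4 * crossMass σ Y ≤
      n / k * (256 * (2 * τ) ^ 2 * Real.exp (-(snr μ τ ^ 2 / 4096)) * (6 * n * k)) := by
  have hsnr := snr_mul_self μ hτ.ne'
  have hoperator : 4 * (2 * τ) ^ 2 * (3 * n + d) / (n / k) ≤ (minSep μ / 32) ^ 2 := by
    rcases n.eq_zero_or_pos with rfl | hn
    · simp [sq_nonneg]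
    calc 4 * (2 * τ) ^ 2 * (3 * n + d) / (n / k)
        = 16384 * (k * d / n + 3 * k) * (τ / 32) ^ 2 := by field_simp; ring
      _ ≤ snr μ τ ^ 2 * (τ / 32) ^ 2 := by gcongr
      _ = (minSep μ / 32) ^ 2 := by rw [← hsnr]; ring
  refine (SGMM.crossMass_le (μ := μ) (g := x)
    (w := fun i b => 256 * (2 * τ) ^ 2 * Real.exp (-(snr μ τ ^ 2 / 4096)) *
      Real.exp ((⟪x i, centerDirection μ σ i b⟫_ℝ / (2 * τ)) ^ 2 / 2))
    hσ hY.1 hΔ (fun a b => minSep_le μ) (by positivity)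
    (by simpa using hx.sum_inner_sq_le) hoperator hx.abs_inner_sum_erase_le
    (fun i b => by positivity) (fun i b hib => ?_)
    (hY.sum_sub_trueClusterMatrix_mul_nonpos hσ)).trans ?_
  · have hsep := minSep_le μ hib
    exact four_mul_inner_le (by positivity) (norm_pos_iff.1 (hΔ.trans_le hsep))
      (div_nonneg hΔ.le hτ.le) (by linarith)
  · simp only [← Finset.mul_sum]
    gcongr
    exact hx.sum_exp_le

theorem NoiseBounds.relative_error_le (hσ : ∀ a, (#(cluster σ a) : ℝ) = n / k) (hn : 0 < n)
    (hτ : 0 < τ) (hs : 16384 * (k * d / n + 3 * k) ≤ snr μ τ ^ 2)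
    (hx : NoiseBounds σ x (centerDirection μ σ) (2 * τ) (n / k * (minSep μ ^ 2 / 64)))
    (hY : IsSDPSolution k (fun i => μ (σ i) + x i) Y) :
    l1Norm (Y - trueClusterMatrix σ) / l1Norm (trueClusterMatrix σ) ≤
      49152 * Real.exp (-(snr μ τ ^ 2 / 4096)) := by
  have hk : (0 : ℝ) < k := Nat.cast_pos.2 (Fin.pos (σ ⟨0, hn⟩))
  have hsk : k ≤ snr μ τ ^ 2 := by
    have : (0 : ℝ) ≤ k * d / n := by positivity
    linarith
  have hΔ : 0 < minSep μ := by
    refine (minSep_nonneg μ).lt_of_ne fun h => ?_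
    rw [snr, ← h, zero_div] at hsk
    linarith
  rw [hY.1.l1Norm_sub_trueClusterMatrix hσ, l1Norm_trueClusterMatrix hσ,
    div_le_iff₀ (by positivity)]
  refine le_of_mul_le_mul_left ?_ (show 0 < minSep μ ^ 2 / 4 by positivity)
  calc minSep μ ^ 2 / 4 * (2 * crossMass σ Y)
      = 2 * (minSep μ ^ 2 / 4 * crossMass σ Y) := by ring
    _ ≤ 2 * (n / k * (256 * (2 * τ) ^ 2 * Real.exp (-(snr μ τ ^ 2 / 4096)) * (6 * n * k))) :=
        mul_le_mul_of_nonneg_left (hx.crossMass_le hσ hτ hΔ hs hY) zero_le_two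
    _ = k * (12288 * τ ^ 2 * Real.exp (-(snr μ τ ^ 2 / 4096)) * (n * (n / k))) := by ring
    _ ≤ snr μ τ ^ 2 * (12288 * τ ^ 2 * Real.exp (-(snr μ τ ^ 2 / 4096)) * (n * (n / k))) := by
        gcongr
    _ = minSep μ ^ 2 / 4 * (49152 * Real.exp (-(snr μ τ ^ 2 / 4096)) * (n * (n / k))) := by
        rw [← snr_mul_self μ hτ.ne']
        ring

variable {Ω : Type*} [MeasurableSpace Ω] {P : Measure Ω} [IsProbabilityMeasure P]
  {g : Fin n → Ω → EuclideanSpace ℝ (Fin d)}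

theorem exists_event_relative_error_le (hn : 2 ≤ n) (hmodel : IsModel P σ g τ)
    (hs : 100000 * (√(k * d / n * Real.log n) + k * d / n + k) ≤ snr μ τ ^ 2) :
    ∃ A : Set Ω, MeasurableSet A ∧ 1 - 2 / (n : ℝ) ≤ P.real A ∧
      ∀ ω ∈ A, (∃ Y, IsSDPSolution k (point μ σ g ω) Y) ∧
        ∀ Y, IsSDPSolution k (point μ σ g ω) Y →
          l1Norm (Y - trueClusterMatrix σ) / l1Norm (trueClusterMatrix σ) ≤
            49152 * Real.exp (-(snr μ τ ^ 2 / 4096)) := by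
  have hτ := hmodel.tau_pos
  -- The scale `2 * τ` avoids the question whether the infimum in `psi2Norm` is attained.
  obtain ⟨A, hA, hPA, hnoise⟩ := exists_event_noiseBounds hn hmodel.measurable hmodel.indep
    (fun i => subGaussianVec_of_psi2NormVec_le (T := 2 * τ) (by linarith) (by linarith)
      (hmodel.subgaussian i))
    (by linarith) hmodel.centered hmodel.balanced (norm_centerDirection_le_one μ σ)
    (s := snr μ τ) (by simpa using hs)
  have hscale : snr μ τ * (2 * τ) / 2 = minSep μ := by
    rw [mul_left_comm, mul_div_cancel_left₀ _ two_ne_zero, snr_mul_self μ hτ.ne']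
  have hratio : (0 : ℝ) ≤ k * d / n := by positivity
  refine ⟨A, hA, hPA, fun ω hω => ⟨exists_isSDPSolution _
    ⟨_, trueClusterMatrix_isFeasible hmodel.balanced⟩, fun Y hY => ?_⟩⟩
  refine (hscale ▸ hnoise ω hω).relative_error_le hmodel.balanced (by omega) hτ ?_ hY
  linarith [Real.sqrt_nonneg (k * d / n * Real.log n), Nat.cast_nonneg (α := ℝ) k]

end Recovery

section ExactRecovery

lemma exact_recovery_condition {A n k d s : ℝ} (hA : 0 ≤ A) (hn : 1 ≤ n) (hk : 0 ≤ k)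
    (hd : d ≤ A * n) (hs : 100000 * (2 * A + 1) * (k + Real.log n) ≤ s) :
    100000 * (√(k * d / n * Real.log n) + k * d / n + k) ≤ s := by
  have hL : 0 ≤ Real.log n := Real.log_nonneg hn
  have hAk : 0 ≤ A * k := mul_nonneg hA hk
  have hratio : k * d / n ≤ A * k := by
    rw [div_le_iff₀ (by linarith), mul_comm A, mul_assoc]
    gcongr
  have hsqrt : √(k * d / n * Real.log n) ≤ A * k + Real.log n := by
    rw [Real.sqrt_le_left (by linarith)]
    nlinarith [mul_le_mul_of_nonneg_right hratio hL, mul_nonneg hAk hL]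
  nlinarith [mul_nonneg hA hL]

lemma exact_recovery_error {n k s : ℝ} (hn : 1 ≤ n) (hk : 1 ≤ k)
    (hs : 100000 * (k + Real.log n) ≤ s) :
    49152 * Real.exp (-(s / 4096)) * (n * (n / k)) < 1 / 4 := by
  have hn0 : 0 < n := by linarith
  have hL : 0 ≤ Real.log n := Real.log_nonneg hn
  have hexp : Real.exp (-(s / 4096)) ≤ Real.exp (-20) * (n ^ 2)⁻¹ := by
    calc Real.exp (-(s / 4096)) ≤ Real.exp (-20 + -(2 * Real.log n)) := by
          gcongr
          linarith
      _ = Real.exp (-20) * (n ^ 2)⁻¹ := by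
          rw [Real.exp_add]
          simpa using exp_neg_natCast_mul_log 2 hn0
  have hconst : Real.exp (-20) < 1 / 196608 := by
    rw [Real.exp_neg, ← one_div]
    refine one_div_lt_one_div_of_lt (by norm_num) ?_
    calc (196608 : ℝ) < 2 ^ 20 := by norm_num
      _ ≤ Real.exp 1 ^ 20 := by gcongr; linarith [Real.add_one_le_exp (1 : ℝ)]
      _ = Real.exp 20 := by rw [← Real.exp_nat_mul]; norm_num
  calc 49152 * Real.exp (-(s / 4096)) * (n * (n / k))
      ≤ 49152 * (Real.exp (-20) * (n ^ 2)⁻¹) * (n * n) := by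
        gcongr
        exact div_le_self hn0.le hk
    _ = 49152 * Real.exp (-20) := by field_simp
    _ < 1 / 4 := by linarith

variable {n k d : ℕ} {σ : Fin n → Fin k}

lemma abs_apply_le_l1Norm (M : Matrix (Fin n) (Fin n) ℝ) (i j : Fin n) : |M i j| ≤ l1Norm M :=
  (Finset.single_le_sum (f := fun j => |M i j|) (fun _ _ => abs_nonneg _)
    (Finset.mem_univ j)).trans <|
    Finset.single_le_sum (f := fun i => ∑ j, |M i j|)
      (fun _ _ => Finset.sum_nonneg fun _ _ => abs_nonneg _) (Finset.mem_univ i)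

lemma round_eq_of_abs_sub_lt_half {x : ℝ} {z : ℤ} (h : |x - z| < 1 / 2) : round x = z := by
  rw [abs_lt] at h
  rw [round_eq, Int.floor_eq_iff]
  constructor <;> linarith

lemma roundMatrix_eq_trueClusterMatrix {Y : Matrix (Fin n) (Fin n) ℝ}
    (h : l1Norm (Y - trueClusterMatrix σ) < 1 / 2) : roundMatrix Y = trueClusterMatrix σ := by
  ext i j
  have hentry := (abs_apply_le_l1Norm _ i j).trans_lt h
  simp only [Matrix.sub_apply, roundMatrix, trueClusterMatrix, Matrix.of_apply] at hentry ⊢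
  split_ifs at hentry ⊢
  · rw [round_eq_of_abs_sub_lt_half (z := 1) (by simpa using hentry), Int.cast_one]
  · rw [round_eq_of_abs_sub_lt_half (z := 0) (by simpa using hentry), Int.cast_zero]

variable {Ω : Type*} [MeasurableSpace Ω] {P : Measure Ω} [IsProbabilityMeasure P]
  {μ : Fin k → EuclideanSpace ℝ (Fin d)} {g : Fin n → Ω → EuclideanSpace ℝ (Fin d)} {τ : ℝ}

theorem exists_event_exact_recovery {A₀ : ℝ} (hA₀ : 0 ≤ A₀) (hn : 2 ≤ n) (hd : d ≤ A₀ * n)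
    (hmodel : IsModel P σ g τ)
    (hs : 100000 * (2 * A₀ + 1) * (k + Real.log n) ≤ snr μ τ ^ 2) :
    ∃ A : Set Ω, MeasurableSet A ∧ 1 - 2 / (n : ℝ) ≤ P.real A ∧
      ∀ ω ∈ A, (∃ Y, IsSDPSolution k (point μ σ g ω) Y) ∧
        ∀ Y, IsSDPSolution k (point μ σ g ω) Y →
          l1Norm (Y - trueClusterMatrix σ) < 1 / 4 ∧ roundMatrix Y = trueClusterMatrix σ := by
  have hn1 : (1 : ℝ) ≤ n := by exact_mod_cast one_le_two.trans hn
  have hk1 : (1 : ℝ) ≤ k := by exact_mod_cast Fin.pos (σ ⟨0, by omega⟩)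
  have hL : 0 ≤ Real.log n := Real.log_nonneg hn1
  obtain ⟨A, hA, hPA, hsol⟩ := exists_event_relative_error_le (μ := μ) hn hmodel
    (exact_recovery_condition hA₀ hn1 (by linarith) hd hs)
  refine ⟨A, hA, hPA, fun ω hω => ⟨(hsol ω hω).1, fun Y hY => ?_⟩⟩
  have herror := (hsol ω hω).2 Y hY
  rw [l1Norm_trueClusterMatrix hmodel.balanced, div_le_iff₀ (by positivity)] at herror
  have hquarter := herror.trans_lt (exact_recovery_error hn1 hk1 (by nlinarith))
  exact ⟨hquarter, roundMatrix_eq_trueClusterMatrix (hquarter.trans (by norm_num))⟩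

end ExactRecovery

end SGMM

theorem corollary3 :
    (∃ Cs Cm Ce : ℝ, 0 < Cs ∧ 0 < Cm ∧ 0 < Ce ∧
      ∀ (n k d : ℕ), 4 ≤ n → 2 ≤ k →
        ∀ (Ω : Type u) [MeasurableSpace Ω] (P : Measure Ω) [IsProbabilityMeasure P]
          (μ : Fin k → EuclideanSpace ℝ (Fin d)) (σ : Fin n → Fin k)
          (g : Fin n → Ω → EuclideanSpace ℝ (Fin d)) (τ : ℝ),
          SGMM.IsModel P σ g τ →
          Cs * (Real.sqrt ((k : ℝ) * d / n * Real.log n) + (k : ℝ) * d / n + k)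
            ≤ SGMM.snr μ τ ^ 2 →
          ∃ E : Set Ω, MeasurableSet E ∧ 1 - 2 / (n : ℝ) ≤ P.real E ∧
            ∀ ω ∈ E, (∃ Y, SGMM.IsSDPSolution k (SGMM.point μ σ g ω) Y) ∧
              ∀ Y, SGMM.IsSDPSolution k (SGMM.point μ σ g ω) Y →
                SGMM.l1Norm (Y - SGMM.trueClusterMatrix σ)
                    / SGMM.l1Norm (SGMM.trueClusterMatrix σ)
                  ≤ Cm * Real.exp (-(SGMM.snr μ τ ^ 2 / Ce))) ∧
    (∀ A : ℝ, 0 < A → ∃ C : ℝ, 0 < C ∧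
        ∀ (n k d : ℕ), 4 ≤ n → 2 ≤ k → (d : ℝ) ≤ A * n →
        ∀ (Ω : Type u) [MeasurableSpace Ω] (P : Measure Ω) [IsProbabilityMeasure P]
          (μ : Fin k → EuclideanSpace ℝ (Fin d)) (σ : Fin n → Fin k)
          (g : Fin n → Ω → EuclideanSpace ℝ (Fin d)) (τ : ℝ),
          SGMM.IsModel P σ g τ →
          C * ((k : ℝ) + Real.log n) ≤ SGMM.snr μ τ ^ 2 →
          ∃ E : Set Ω, MeasurableSet E ∧ 1 - 2 / (n : ℝ) ≤ P.real E ∧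
            ∀ ω ∈ E, (∃ Y, SGMM.IsSDPSolution k (SGMM.point μ σ g ω) Y) ∧
              ∀ Y, SGMM.IsSDPSolution k (SGMM.point μ σ g ω) Y →
                SGMM.l1Norm (Y - SGMM.trueClusterMatrix σ) < 1 / 4 ∧
                SGMM.roundMatrix Y = SGMM.trueClusterMatrix σ) := by
  refine ⟨⟨100000, 49152, 4096, by norm_num, by norm_num, by norm_num, ?_⟩, fun A hA =>
    ⟨100000 * (2 * A + 1), by positivity, ?_⟩⟩
  · intro n k d hn _ Ω _ P _ μ σ g τ hmodel hs
    exact SGMM.exists_event_relative_error_le (by omega) hmodel hs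
  · intro n k d hn _ hd Ω _ P _ μ σ g τ hmodel hs
    exact SGMM.exists_event_exact_recovery hA.le (by omega) hd hmodel hs
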